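/- **Setting.** Let $X(t)=m+Y(t)$, $t\in\mathbb Z$, where $m$ is a constant and $\{Y(t)\}$ is a zero-mean wide-sense stationary (real- or complex-valued) process with spectral density $f$ on $[-\pi,\pi]$, i.e. $E[Y(s+t)\overline{Y(s)}]=\int_{-\pi}^{\pi}e^{it\lambda}f(\lambda)\,d\lambda$ for all $s,t\in\mathbb Z$. For $n\ge 0$ consider the linear unbiased estimators $\widehat m=\sum_{k=0}^n c_kX(k)$, $\sum_{k=0}^n c_k=1$, and put $\mathrm{Var}_f(\widehat m)=E|\widehat m-m|^2$. The BLUE $\widehat m_{BLU}=\widehat m_{n,BLU}$ is the one of minimal variance. For $\alpha>-1/2$ let $f_\alpha(\lambda)=(2\pi)^{-1}|1-e^{i\lambda}|^{2\alpha}$ and $$\widehat m_\alpha=\sum_{k=0}^n c_k(n,\alpha)X(k),\qquad c_k(n,\alpha)=\binom nk\frac{B(\alpha+k+1,\alpha+n-k+1)}{B(\alpha+1,\alpha+1)},$$ where $B$ is the Beta function. A function $g$ on $[-\pi,\pi]$ belongs to $ZL_0^+$ if $g(\lambda)=h(\lambda)\prod_{j=1}^r|\lambda-\lambda_j|^{\alpha(j)}$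 with finitely many points $\lambda_j\in[-\pi,\pi]$, exponents $\alpha(j)\ge 0$, and a function $h$ that is Lebesgue integrable over $[-\pi,\pi]$, continuous at $\lambda=0$, and bounded below by a positive constant (but not necessarily bounded above). **Theorem.** Let $f(\lambda)=f_\alpha(\lambda)g(\lambda)$ with $\alpha>-1/2$, $g\in ZL_0^+$ and $g(0)>0$. Then for every $n\ge0$ the BLUE exists and its weights are unique, and $$\mathrm{Var}_f(\widehat m_{BLU})\sim n^{-2\alpha-1}\,\frac{\Gamma(2\alpha+1)\,g(0)}{B(\alpha+1,\alpha+1)}\qquad(n\to\infty).$$ Moreover, $\widehat m_\alpha$ is an unbiased linear estimator (i.e. $\sum_{k=0}^n c_k(n,\alpha)=1$) and is asymptotically efficient: $$\frac{\mathrm{Var}_f(\widehat m_{BLU})}{\mathrm{Var}_f(\widehat m_\alpha)}\to 1\qquad(n\to\infty).$$ -/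

import Mathlib

open MeasureTheory Filter Topology Asymptotics Set
open scoped ComplexConjugate

namespace MeanBLUE

noncomputable section

/-! ### Function classes on `[-π, π]` -/

/-- The class `L₀`: nonnegative, (Lebesgue measurable and) integrable over `[-π, π]`,
continuous at `0`. -/
structure ClassL0 (h : ℝ → ℝ) : Prop where
  nonneg : ∀ x ∈ Icc (-Real.pi) Real.pi, 0 ≤ h x
  integrable : IntegrableOn h (Icc (-Real.pi) Real.pi)
  continuousAt : ContinuousAt h 0

/-- The class `L₀⁺`: members of `L₀` with a positive lower bound on `[-π, π]`. -/
structure ClassL0Pos (h : ℝ → ℝ) : Prop extends ClassL0 h where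
  lower_bound : ∃ c : ℝ, 0 < c ∧ ∀ x ∈ Icc (-Real.pi) Real.pi, c ≤ h x

/-- The class `ZL₀⁺`: functions equal on `[-π, π]` to `h(x) ∏ⱼ |x - zⱼ|^{aⱼ}` with `h ∈ L₀⁺`,
finitely many points `zⱼ ∈ [-π, π]` and real exponents `aⱼ ≥ 0`. -/
def ClassZL0Pos (g : ℝ → ℝ) : Prop :=
  ∃ (h : ℝ → ℝ) (r : ℕ) (z a : Fin r → ℝ), ClassL0Pos h ∧
    (∀ j, z j ∈ Icc (-Real.pi) Real.pi) ∧ (∀ j, 0 ≤ a j) ∧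
    ∀ x ∈ Icc (-Real.pi) Real.pi, g x = h x * ∏ j, |x - z j| ^ a j

/-- `f_α(x) = (2π)⁻¹ |1 - e^{ix}|^{2α}`. -/
def fAlpha (α : ℝ) (x : ℝ) : ℝ :=
  (2 * Real.pi)⁻¹ * ‖1 - Complex.exp (Complex.I * x)‖ ^ (2 * α)

/-! ### Stationary processes and linear estimators of the mean -/

/-- `Y` is a zero-mean wide-sense stationary process (real valued for `𝕜 = ℝ`, complex valued for
`𝕜 = ℂ`) with spectral density `f` on `[-π, π]`: its covariances are
`E[Y(s+t) conj(Y(s))] = ∫_{-π}^{π} e^{itx} f(x) dx`. The map `RCLike.map 𝕜 ℂ` is the inclusion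
of `𝕜` into `ℂ`. -/
structure HasSpectralDensity {𝕜 Ω : Type*} [RCLike 𝕜] [MeasurableSpace Ω]
    (P : Measure Ω) (Y : ℤ → Ω → 𝕜) (f : ℝ → ℝ) : Prop where
  density_nonneg : ∀ x ∈ Icc (-Real.pi) Real.pi, 0 ≤ f x
  density_integrable : IntegrableOn f (Icc (-Real.pi) Real.pi)
  memLp : ∀ t, MemLp (Y t) 2 P
  mean_zero : ∀ t, ∫ ω, Y t ω ∂P = 0
  covariance : ∀ s t : ℤ,
    RCLike.map 𝕜 ℂ (∫ ω, Y (s + t) ω * conj (Y s ω) ∂P) =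
      ∫ x in (-Real.pi)..Real.pi, Complex.exp (Complex.I * t * x) * (f x : ℂ)

/-- The linear estimator `∑_{k=0}^n c_k X(k)`. -/
def linearEstimator {𝕜 Ω : Type*} [RCLike 𝕜] (X : ℤ → Ω → 𝕜) {n : ℕ} (c : Fin (n + 1) → 𝕜)
    (ω : Ω) : 𝕜 :=
  ∑ k : Fin (n + 1), c k * X ((k : ℕ) : ℤ) ω

/-- The variance `E|m̂ - m|²` of the linear estimator `m̂` with weights `c`. -/
def estimatorVar {𝕜 Ω : Type*} [RCLike 𝕜] [MeasurableSpace Ω] (P : Measure Ω)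
    (X : ℤ → Ω → 𝕜) (m : 𝕜) {n : ℕ} (c : Fin (n + 1) → 𝕜) : ℝ :=
  ∫ ω, ‖linearEstimator X c ω - m‖ ^ 2 ∂P

/-- `c` is a vector of weights of a best linear unbiased estimator of the mean `m` based on
`X(0), …, X(n)`: the weights sum to `1`, and the variance is minimal among all such weights. -/
def IsBLUE {𝕜 Ω : Type*} [RCLike 𝕜] [MeasurableSpace Ω] (P : Measure Ω)
    (X : ℤ → Ω → 𝕜) (m : 𝕜) {n : ℕ} (c : Fin (n + 1) → 𝕜) : Prop :=
  ∑ k, c k = 1 ∧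
    ∀ d : Fin (n + 1) → 𝕜, ∑ k, d k = 1 → estimatorVar P X m c ≤ estimatorVar P X m d

/-- The weights `c_k(n, α) = (n choose k) B(α+k+1, α+n-k+1) / B(α+1, α+1)` of the estimator
`m̂_α`; `ProbabilityTheory.beta` is the real Beta function. -/
def alphaWeights (𝕜 : Type*) [RCLike 𝕜] (α : ℝ) (n : ℕ) (k : Fin (n + 1)) : 𝕜 :=
  (((n.choose k : ℝ) *
    ProbabilityTheory.beta (α + (k : ℕ) + 1) (α + n - (k : ℕ) + 1) /
      ProbabilityTheory.beta (α + 1) (α + 1) : ℝ) : 𝕜)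

end

end MeanBLUE

/-!
For weights summing to `1` the variance of `∑ c_k X(k)` is the quadratic form
`∫ |p(e^{ix})|² f(x) dx` of the polynomial `p(z) = ∑ c_k z^k`, which satisfies `p(1) = 1`
(`HasSpectralDensity.estimatorVar_eq`). Since `f > 0` almost everywhere the form is definite, and
the BLUE is the point of an affine hyperplane nearest to the origin
(`HasSpectralDensity.exists_isBLUE_iff`). The asymptotics come from three facts.

*The case `g = 1` is explicit.* With the weights `c_k(n, α)`, all covariances of the estimator with
`X(0), …, X(n)` are equal to `V_n = n! Γ(2α + 1) / (Γ(n + 2α + 2) B(α + 1, α + 1))`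
(`sum_alphaCoef_mul_covAlpha`), so that these weights are optimal with variance `V_n`
(`minVar_mul_le_specForm`). The Fourier coefficients of `f_α` satisfy a first-order recurrence in
`k` (`covAlpha_succ`), and so do the weights. The difference of two consecutive covariances is then
a Saalschützian hypergeometric sum, for which creative telescoping gives a first-order recurrence
(`sum_mul_shift_recurrence`) forcing it to vanish. The common value of the covariances is a
Chu–Vandermonde sum, and `n^{2α+1} V_n → Γ(2α + 1) / B(α + 1, α + 1)` is Euler's limit formula.

*Upper bound.* The polynomial of the weights `c_k(n, α)` is the mean of `(1 - t + t z)^n` over a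
Beta distribution of `t`, so it is `O(n^{-α-1})` on the unit circle away from `z = 1`
(`norm_eval_alphaPoly_le`). This is smaller than `√V_n`; hence only the values of `g` near `0`
matter, and the variance of `m̂_α` for `f_α g` is asymptotically `g(0) V_n`
(`tendsto_rpow_mul_specForm_alphaPoly`).

*Lower bound.* For every `t < g(0)` there is a polynomial `q` with `|q(e^{ix})|² ≤ g(x)` on
`[-π, π]` and `|q(1)|² = t` (`exists_polynomial_sq_le_of_le`): the power zeros of `g` are
dominated by zeros of `q`, and a high power of `(1 + z) / 2` makes `q` small away from `z = 1`. If
`q` has degree `d`, then `∫ |p|² f_α g ≥ ∫ |p q|² f_α ≥ t V_{n+d}` for every `p` of degree at most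
`n` with `p(1) = 1`, and `V_{n+d} ∼ V_n`.
-/

namespace MeanBLUE

/-! ### Hypergeometric summation identities -/

/-- The Chu–Vandermonde convolution in recursive form: the binomial convolution of the rising
factorials `(x)_k` and `(y)_k` satisfies the recurrence of `(x + y)_n`. -/
theorem sum_choose_mul_succ {e f : ℕ → ℝ} {x y : ℝ} (he : ∀ k, e (k + 1) = (k + x) * e k)
    (hf : ∀ k, f (k + 1) = (k + y) * f k) (n : ℕ) :
    ∑ k ∈ Finset.range (n + 2), ((n + 1).choose k : ℝ) * (e k * f (n + 1 - k)) =
      (x + y + n) * ∑ k ∈ Finset.range (n + 1), (n.choose k : ℝ) * (e k * f (n - k)) := by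
  have h := Finset.sum_antidiagonal_choose_succ_mul (R := ℝ) (fun i j => e i * f j) n
  rw [Finset.Nat.sum_antidiagonal_eq_sum_range_succ
      (fun i j => ((n + 1).choose i : ℝ) * (e i * f j)),
    Finset.Nat.sum_antidiagonal_eq_sum_range_succ
      (fun i j => ((n).choose i : ℝ) * (e i * f (j + 1))),
    Finset.Nat.sum_antidiagonal_eq_sum_range_succ
      (fun i j => ((n).choose j : ℝ) * (e (i + 1) * f j)), ← Finset.sum_add_distrib] at h
  rw [show n + 2 = (n + 1).succ from rfl, h, Finset.mul_sum]
  refine Finset.sum_congr rfl fun k hk => ?_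
  have hk' : k ≤ n := Nat.lt_succ_iff.mp (Finset.mem_range.mp hk)
  rw [Nat.choose_symm hk', he, hf, Nat.cast_sub hk']
  ring

/-- A first-order recurrence in `j` for the convolution `∑ u_k δ(j - k)`. The summands of the two
sides differ by `G (k + 1) - G k` with `G k = k (α + n + 1 - k) u_k δ(j + 1 - k)`. -/
theorem sum_mul_shift_recurrence {α : ℝ} (hα : -1 / 2 < α) {n : ℕ} {u : ℕ → ℝ} {δ : ℤ → ℝ}
    (hu : ∀ k ≤ n, u (k + 1) * ((k + 1) * (α + n - k)) = u k * ((n - k) * (α + k + 1)))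
    (hδ : ∀ m : ℤ, δ (m + 1) * (α + m + 2) = δ m * (m - α)) (j : ℤ) :
    (j + 1 - n) * (α + j + 2) * ∑ k ∈ Finset.range (n + 1), u k * δ (j + 1 - k) =
      (j + 1) * (j - n - α) * ∑ k ∈ Finset.range (n + 1), u k * δ (j - k) := by
  rw [← sub_eq_zero, Finset.mul_sum, Finset.mul_sum, ← Finset.sum_sub_distrib]
  -- the telescoping certificate
  set G : ℕ → ℝ := fun k => u k * (k * (α + n + 1 - k)) * δ (j + 1 - k) with hG
  have key : ∀ k ∈ Finset.range (n + 1),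
      (j + 1 - n) * (α + j + 2) * (u k * δ (j + 1 - k)) -
        (j + 1) * (j - n - α) * (u k * δ (j - k)) = G (k + 1) - G k := by
    intro k hk
    have hk' : k ≤ n := Nat.lt_succ_iff.mp (Finset.mem_range.mp hk)
    have h1 := hu k hk'
    have h2 := hδ (j - k)
    have h3 : (2 * α + 2) ≠ 0 := by linarith
    -- consecutive values of `δ` are multiples of a common quantity `D`
    obtain ⟨D, hD1, hD2⟩ : ∃ D : ℝ, δ (j - k) = (α + j - k + 2) * D ∧
        δ (j + 1 - k) = (j - k - α) * D := by
      refine ⟨(δ (j - k) - δ (j + 1 - k)) / (2 * α + 2), ?_, ?_⟩ <;>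
      · rw [show j - k + 1 = j + 1 - (k : ℤ) by ring] at h2
        push_cast at h2
        rw [mul_div_assoc', eq_div_iff h3]
        linear_combination h2
    have h4 : G (k + 1) = u k * ((n - k) * (α + k + 1)) * δ (j - k) := by
      rw [hG, ← h1]
      simp only
      rw [show j + 1 - ((k + 1 : ℕ) : ℤ) = j - k by push_cast; ring]
      push_cast
      ring
    rw [h4, hG, hD1]
    simp only
    rw [hD2]
    ring
  rw [Finset.sum_congr rfl key, Finset.sum_range_sub]
  have h0 : u (n + 1) * ((n + 1) * α) = 0 := by simpa using hu n le_rfl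
  rw [hG]
  push_cast
  simp only [zero_mul, mul_zero, sub_zero]
  rw [show α + n + 1 - (n + 1) = α by ring, h0, zero_mul]

/-- The factor `j + 1` of the recurrence vanishes at `j = -1`, so the convolution is zero at
`j = 0`; the factor `j + 1 - n` does not vanish before `j = n - 1`, so the zeros propagate up
to there. -/
theorem sum_mul_shift_eq_zero {α : ℝ} (hα : -1 / 2 < α) {n : ℕ} {u : ℕ → ℝ} {δ : ℤ → ℝ}
    (hu : ∀ k ≤ n, u (k + 1) * ((k + 1) * (α + n - k)) = u k * ((n - k) * (α + k + 1)))
    (hδ : ∀ m : ℤ, δ (m + 1) * (α + m + 2) = δ m * (m - α)) (j : ℕ) (hj : j < n) :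
    ∑ k ∈ Finset.range (n + 1), u k * δ (j - k) = 0 := by
  induction j with
  | zero =>
    have h := sum_mul_shift_recurrence hα hu hδ (-1)
    have hn : (n : ℝ) ≠ 0 := by positivity
    have h1 : α + 1 ≠ 0 := by linarith
    norm_num at h
    rcases h with h | h
    · rcases h with h | h
      · omega
      · exact absurd (by linarith) h1
    · simpa using h
  | succ j ih =>
    have h := sum_mul_shift_recurrence hα hu hδ j
    rw [ih (by omega), mul_zero] at h
    have h1 : ((j : ℤ) + 1 - n : ℝ) ≠ 0 := by
      have : ((j + 1 : ℕ) : ℝ) < n := by exact_mod_cast hj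
      push_cast at this ⊢
      linarith
    have h2 : (α + (j : ℤ) + 2 : ℝ) ≠ 0 := by
      have : (0 : ℝ) ≤ j := by positivity
      push_cast
      linarith
    simpa using (mul_eq_zero.mp h).resolve_left (mul_ne_zero h1 h2)

/-! ### The real Beta integral -/

theorem integrableOn_rpow_mul_one_sub_rpow {a b : ℝ} (ha : 0 < a) (hb : 0 < b) :
    IntegrableOn (fun x : ℝ => x ^ (a - 1) * (1 - x) ^ (b - 1)) (Ioo 0 1) := by
  have h := Complex.betaIntegral_convergent (u := a) (v := b) (by simpa) (by simpa)
  rw [intervalIntegrable_iff_integrableOn_Ioo_of_le zero_le_one] at h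
  refine IntegrableOn.congr_fun h.re (fun x hx => ?_) measurableSet_Ioo
  rw [show (1 - (x : ℂ)) = ((1 - x : ℝ) : ℂ) by push_cast; ring,
    show ((a : ℂ) - 1) = ((a - 1 : ℝ) : ℂ) by push_cast; ring,
    show ((b : ℂ) - 1) = ((b - 1 : ℝ) : ℂ) by push_cast; ring,
    ← Complex.ofReal_cpow hx.1.le, ← Complex.ofReal_cpow (by linarith [hx.2]),
    ← Complex.ofReal_mul, RCLike.re_to_complex, Complex.ofReal_re]

theorem integral_rpow_mul_one_sub_rpow {a b : ℝ} (ha : 0 < a) (hb : 0 < b) :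
    ∫ x in Ioo (0 : ℝ) 1, x ^ (a - 1) * (1 - x) ^ (b - 1) = ProbabilityTheory.beta a b := by
  have h := Complex.betaIntegral_convergent (u := a) (v := b) (by simpa) (by simpa)
  rw [intervalIntegrable_iff_integrableOn_Ioo_of_le zero_le_one] at h
  rw [ProbabilityTheory.beta_eq_betaIntegralReal a b ha hb, Complex.betaIntegral,
    intervalIntegral.integral_of_le zero_le_one, integral_Ioc_eq_integral_Ioo,
    ← RCLike.re_to_complex, ← integral_re h]
  refine setIntegral_congr_fun measurableSet_Ioo fun x hx => ?_
  rw [show (1 - (x : ℂ)) = ((1 - x : ℝ) : ℂ) by push_cast; ring,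
    show ((a : ℂ) - 1) = ((a - 1 : ℝ) : ℂ) by push_cast; ring,
    show ((b : ℂ) - 1) = ((b - 1 : ℝ) : ℂ) by push_cast; ring,
    ← Complex.ofReal_cpow hx.1.le, ← Complex.ofReal_cpow (by linarith [hx.2]),
    ← Complex.ofReal_mul, RCLike.re_to_complex, Complex.ofReal_re]

/-! ### Fourier coefficients of `f_α` -/

theorem image_sin_half_sq : (fun x : ℝ => Real.sin (x / 2) ^ 2) '' Ioo 0 Real.pi = Ioo 0 1 := by
  ext y
  constructor
  · rintro ⟨x, hx, rfl⟩
    have h1 : 0 < Real.sin (x / 2) :=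
      Real.sin_pos_of_pos_of_lt_pi (by linarith [hx.1]) (by linarith [hx.2, Real.pi_pos])
    have h2 : 0 < Real.cos (x / 2) :=
      Real.cos_pos_of_mem_Ioo ⟨by linarith [hx.1, Real.pi_pos], by linarith [hx.2]⟩
    have h3 := Real.sin_sq_add_cos_sq (x / 2)
    exact ⟨by positivity, by simp only; nlinarith⟩
  · rintro ⟨hy0, hy1⟩
    have h0 : 0 < √y := Real.sqrt_pos.mpr hy0
    have h1 : √y < 1 := by
      rw [Real.sqrt_lt' one_pos]
      simpa using hy1
    refine ⟨2 * Real.arcsin √y, ⟨by linarith [Real.arcsin_pos.mpr h0], ?_⟩, ?_⟩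
    · linarith [Real.arcsin_lt_pi_div_two.mpr h1]
    · simp only
      rw [mul_div_cancel_left₀ _ two_ne_zero, Real.sin_arcsin (by linarith) h1.le,
        Real.sq_sqrt hy0.le]

theorem injOn_sin_half_sq : InjOn (fun x : ℝ => Real.sin (x / 2) ^ 2) (Ioo 0 Real.pi) := by
  intro x hx y hy h
  simp only at h
  have hx1 : 0 < Real.sin (x / 2) :=
    Real.sin_pos_of_pos_of_lt_pi (by linarith [hx.1]) (by linarith [hx.2, Real.pi_pos])
  have hy1 : 0 < Real.sin (y / 2) :=
    Real.sin_pos_of_pos_of_lt_pi (by linarith [hy.1]) (by linarith [hy.2, Real.pi_pos])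
  have h2 := (pow_left_inj₀ hx1.le hy1.le two_ne_zero).mp h
  have h3 := Real.injOn_sin ⟨by linarith [hx.1, Real.pi_pos], by linarith [hx.2]⟩
    ⟨by linarith [hy.1, Real.pi_pos], by linarith [hy.2]⟩ h2
  linarith

theorem hasDerivWithinAt_sin_half_sq (x : ℝ) (s : Set ℝ) :
    HasDerivWithinAt (fun x : ℝ => Real.sin (x / 2) ^ 2) (Real.sin (x / 2) * Real.cos (x / 2))
      s x := by
  have h := (((Real.hasDerivAt_sin (x / 2)).comp x ((hasDerivAt_id x).div_const 2)).pow 2)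
  refine (h.congr_deriv ?_).hasDerivWithinAt
  simp
  ring

/-- The substitution `y = sin² (x / 2)` turns the Beta integrand with parameters `α + 1/2`, `1/2`
into `sin (x / 2) ^ (2α)`. -/
theorem abs_deriv_mul_beta_integrand {α x : ℝ} (hx : x ∈ Ioo 0 Real.pi) :
    |Real.sin (x / 2) * Real.cos (x / 2)| • ((Real.sin (x / 2) ^ 2) ^ (α + 1 / 2 - 1) *
      (1 - Real.sin (x / 2) ^ 2) ^ ((1 / 2 : ℝ) - 1)) = Real.sin (x / 2) ^ (2 * α) := by
  have h1 : 0 < Real.sin (x / 2) :=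
    Real.sin_pos_of_pos_of_lt_pi (by linarith [hx.1]) (by linarith [hx.2, Real.pi_pos])
  have h2 : 0 < Real.cos (x / 2) :=
    Real.cos_pos_of_mem_Ioo ⟨by linarith [hx.1, Real.pi_pos], by linarith [hx.2]⟩
  rw [abs_of_pos (by positivity), ← Real.cos_sq', smul_eq_mul, ← Real.rpow_natCast,
    ← Real.rpow_natCast, ← Real.rpow_mul h1.le, ← Real.rpow_mul h2.le,
    show ((2 : ℕ) : ℝ) * (1 / 2 - 1) = -1 by norm_num, Real.rpow_neg_one,
    show ((2 : ℕ) : ℝ) * (α + 1 / 2 - 1) = 2 * α - 1 by push_cast; ring,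
    Real.rpow_sub_one h1.ne']
  field_simp

theorem integrableOn_sin_half_rpow {α : ℝ} (hα : -1 / 2 < α) :
    IntegrableOn (fun x : ℝ => Real.sin (x / 2) ^ (2 * α)) (Ioo 0 Real.pi) := by
  have h := integrableOn_rpow_mul_one_sub_rpow (a := α + 1 / 2) (b := 1 / 2) (by linarith)
    (by norm_num)
  rw [← image_sin_half_sq, integrableOn_image_iff_integrableOn_abs_deriv_smul measurableSet_Ioo
    (fun x _ => hasDerivWithinAt_sin_half_sq x _) injOn_sin_half_sq] at h
  exact h.congr_fun (fun x hx => abs_deriv_mul_beta_integrand hx) measurableSet_Ioo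

theorem integral_sin_half_rpow {α : ℝ} (hα : -1 / 2 < α) :
    ∫ x in Ioo 0 Real.pi, Real.sin (x / 2) ^ (2 * α) =
      ProbabilityTheory.beta (α + 1 / 2) (1 / 2) := by
  rw [← integral_rpow_mul_one_sub_rpow (by linarith) (by norm_num), ← image_sin_half_sq,
    integral_image_eq_integral_abs_deriv_smul measurableSet_Ioo
      (fun x _ => hasDerivWithinAt_sin_half_sq x _) injOn_sin_half_sq]
  exact setIntegral_congr_fun measurableSet_Ioo fun x hx =>
    (abs_deriv_mul_beta_integrand hx).symm

/-- The Fourier coefficient `∫_{-π}^{π} e^{ikx} f_α(x) dx`, which is real because `f_α` is even,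
as an integral over the half period, where `|1 - e^{ix}| = 2 sin (x / 2)`. -/
noncomputable def covAlpha (α : ℝ) (k : ℤ) : ℝ :=
  Real.pi⁻¹ * ∫ x in (0 : ℝ)..Real.pi, (2 * Real.sin (x / 2)) ^ (2 * α) * Real.cos (k * x)

theorem intervalIntegrable_two_mul_sin_half_rpow {α : ℝ} (hα : -1 / 2 < α) :
    IntervalIntegrable (fun x : ℝ => (2 * Real.sin (x / 2)) ^ (2 * α)) volume 0 Real.pi := by
  rw [intervalIntegrable_iff_integrableOn_Ioo_of_le Real.pi_pos.le]
  refine IntegrableOn.congr_fun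
    ((integrableOn_sin_half_rpow hα).integrable.const_mul ((2 : ℝ) ^ (2 * α)))
    (fun x hx => ?_) measurableSet_Ioo
  exact (Real.mul_rpow zero_le_two (Real.sin_nonneg_of_nonneg_of_le_pi (by linarith [hx.1])
    (by linarith [hx.2, Real.pi_pos]))).symm

theorem intervalIntegrable_covAlpha {α : ℝ} (hα : -1 / 2 < α) (k : ℝ) :
    IntervalIntegrable (fun x : ℝ => (2 * Real.sin (x / 2)) ^ (2 * α) * Real.cos (k * x))
      volume 0 Real.pi :=
  (intervalIntegrable_two_mul_sin_half_rpow hα).mul_continuousOn (by fun_prop)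

/-- The Beta integral `B(α + 1/2, 1/2)`, simplified by the duplication formula of the Gamma
function. -/
theorem covAlpha_zero {α : ℝ} (hα : -1 / 2 < α) :
    covAlpha α 0 = Real.Gamma (2 * α + 1) / Real.Gamma (α + 1) ^ 2 := by
  have h1 : ∫ x in (0 : ℝ)..Real.pi, (2 * Real.sin (x / 2)) ^ (2 * α) * Real.cos ((0 : ℤ) * x) =
      2 ^ (2 * α) * ProbabilityTheory.beta (α + 1 / 2) (1 / 2) := by
    rw [intervalIntegral.integral_of_le Real.pi_pos.le, integral_Ioc_eq_integral_Ioo,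
      ← integral_sin_half_rpow hα, ← integral_const_mul]
    refine setIntegral_congr_fun measurableSet_Ioo fun x hx => ?_
    simp only [Int.cast_zero, zero_mul, Real.cos_zero, mul_one]
    exact Real.mul_rpow zero_le_two (Real.sin_nonneg_of_nonneg_of_le_pi (by linarith [hx.1])
      (by linarith [hx.2, Real.pi_pos]))
  have h2 := Real.Gamma_mul_Gamma_add_half (α + 1 / 2)
  rw [show α + 1 / 2 + 1 / 2 = α + 1 by ring, show 2 * (α + 1 / 2) = 2 * α + 1 by ring,
    show 1 - (2 * α + 1) = -(2 * α) by ring, Real.rpow_neg zero_le_two] at h2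
  have h3 : 0 < Real.Gamma (α + 1) := Real.Gamma_pos_of_pos (by linarith)
  have h4 : (0 : ℝ) < 2 ^ (2 * α) := by positivity
  have h5 : Real.Gamma (α + 1 / 2) =
      Real.Gamma (2 * α + 1) * (2 ^ (2 * α))⁻¹ * √Real.pi / Real.Gamma (α + 1) := by
    rw [← h2, mul_div_cancel_right₀ _ h3.ne']
  have h6 : √Real.pi * √Real.pi = Real.pi := Real.mul_self_sqrt Real.pi_pos.le
  have hpi := Real.pi_pos
  rw [covAlpha, h1, ProbabilityTheory.beta, show α + 1 / 2 + 1 / 2 = α + 1 by ring, h5,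
    Real.Gamma_one_half_eq]
  calc _ = Real.pi⁻¹ * (√Real.pi * √Real.pi) * (2 ^ (2 * α) * (2 ^ (2 * α))⁻¹) *
        (Real.Gamma (2 * α + 1) / Real.Gamma (α + 1) ^ 2) := by ring
    _ = _ := by
      rw [h6, inv_mul_cancel₀ hpi.ne', mul_inv_cancel₀ h4.ne', one_mul, one_mul]

/-- Obtained by integrating the derivative of `(2 sin (x / 2)) ^ (2α + 1) cos ((k + 1/2) x)`, which
vanishes at both ends of `[0, π]`. -/
theorem covAlpha_succ {α : ℝ} (hα : -1 / 2 < α) (k : ℤ) :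
    covAlpha α (k + 1) * (α + k + 1) = covAlpha α k * (k - α) := by
  set F : ℝ → ℝ := fun x => (2 * Real.sin (x / 2)) ^ (2 * α + 1) * Real.cos ((k + 1 / 2) * x)
  set c : ℤ → ℝ → ℝ := fun k x => (2 * Real.sin (x / 2)) ^ (2 * α) * Real.cos (k * x) with hc
  have hci : ∀ k, IntervalIntegrable (c k) volume 0 Real.pi :=
    fun k => intervalIntegrable_covAlpha hα k
  have hint := ((hci (k + 1)).const_mul (α + k + 1)).sub ((hci k).const_mul (k - α))
  have hftc : ∫ x in (0 : ℝ)..Real.pi, ((α + k + 1) * c (k + 1) x - (k - α) * c k x) =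
      F Real.pi - F 0 := by
    refine intervalIntegral.integral_eq_sub_of_hasDerivAt_of_le Real.pi_pos.le ?_ ?_ hint
    · refine ContinuousOn.mul (ContinuousOn.rpow_const (by fun_prop) ?_) (by fun_prop)
      exact fun x _ => Or.inr (by linarith)
    · intro x hx
      have h1 : 0 < 2 * Real.sin (x / 2) := mul_pos two_pos
        (Real.sin_pos_of_pos_of_lt_pi (by linarith [hx.1]) (by linarith [hx.2, Real.pi_pos]))
      have hd1 : HasDerivAt (fun x : ℝ => 2 * Real.sin (x / 2)) (Real.cos (x / 2)) x := by
        have h := ((Real.hasDerivAt_sin (x / 2)).comp x ((hasDerivAt_id x).div_const 2)).const_mul 2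
        refine h.congr_deriv ?_
        simp
        ring
      have hd2 : HasDerivAt (fun x : ℝ => Real.cos ((k + 1 / 2) * x))
          (-Real.sin ((k + 1 / 2) * x) * (k + 1 / 2)) x := by
        have h := (Real.hasDerivAt_cos ((k + 1 / 2) * x)).comp x
          ((hasDerivAt_id x).const_mul ((k : ℝ) + 1 / 2))
        exact h.congr_deriv (by simp)
      refine ((hd1.rpow_const (p := 2 * α + 1) (Or.inl h1.ne')).mul hd2).congr_deriv ?_
      have e1 : Real.cos (((k + 1 : ℤ) : ℝ) * x) =
          Real.cos ((k + 1 / 2) * x) * Real.cos (x / 2) -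
            Real.sin ((k + 1 / 2) * x) * Real.sin (x / 2) := by
        rw [← Real.cos_add]
        congr 1
        push_cast
        ring
      have e2 : Real.cos (k * x) =
          Real.cos ((k + 1 / 2) * x) * Real.cos (x / 2) +
            Real.sin ((k + 1 / 2) * x) * Real.sin (x / 2) := by
        rw [← Real.cos_sub]
        congr 1
        ring
      simp only [hc]
      rw [e1, e2, show 2 * α + 1 - 1 = 2 * α by ring, Real.rpow_add_one h1.ne']
      ring
  have hF0 : F 0 = 0 := by
    simp only [F]
    rw [zero_div, Real.sin_zero, mul_zero, Real.zero_rpow (by linarith), zero_mul]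
  have hFpi : F Real.pi = 0 := by
    simp only [F]
    have : Real.cos ((k + 1 / 2) * Real.pi) = 0 := by
      rw [Real.cos_eq_zero_iff]
      exact ⟨k, by ring⟩
    rw [this, mul_zero]
  rw [intervalIntegral.integral_sub ((hci (k + 1)).const_mul _) ((hci k).const_mul _),
    intervalIntegral.integral_const_mul, intervalIntegral.integral_const_mul, hF0, hFpi] at hftc
  simp only [covAlpha]
  simp only [hc] at hftc
  linear_combination Real.pi⁻¹ * hftc

/-! ### The weights `c_k(n, α)` -/

/-- The weight `c_k(n, α)` as a real number, for every natural number `k` (it vanishes for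
`k > n`). -/
noncomputable def alphaCoef (α : ℝ) (n k : ℕ) : ℝ :=
  (n.choose k : ℝ) * ProbabilityTheory.beta (α + k + 1) (α + n - k + 1) /
    ProbabilityTheory.beta (α + 1) (α + 1)

/-- The variance of `∑ c_k(n, α) X(k)` for the spectral density `f_α`, which is also the minimal
one. -/
noncomputable def minVar (α : ℝ) (n : ℕ) : ℝ :=
  n.factorial * Real.Gamma (2 * α + 1) /
    (Real.Gamma (n + 2 * α + 2) * ProbabilityTheory.beta (α + 1) (α + 1))

theorem alphaCoef_eq (α : ℝ) (n k : ℕ) :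
    alphaCoef α n k = (n.choose k : ℝ) *
      (Real.Gamma (α + k + 1) * Real.Gamma (α + n - k + 1)) /
        (Real.Gamma (n + 2 * α + 2) * ProbabilityTheory.beta (α + 1) (α + 1)) := by
  rw [alphaCoef]
  conv_lhs => enter [1, 2]; rw [ProbabilityTheory.beta]
  rw [show α + k + 1 + (α + n - k + 1) = n + 2 * α + 2 by ring]
  ring

theorem beta_add_one_pos {α : ℝ} (hα : -1 / 2 < α) :
    0 < ProbabilityTheory.beta (α + 1) (α + 1) :=
  ProbabilityTheory.beta_pos (by linarith) (by linarith)

theorem alphaCoef_recurrence {α : ℝ} (hα : -1 / 2 < α) {n k : ℕ} (hk : k ≤ n) :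
    alphaCoef α n (k + 1) * ((k + 1) * (α + n - k)) =
      alphaCoef α n k * ((n - k) * (α + k + 1)) := by
  have hk0 : (0 : ℝ) ≤ k := by positivity
  rcases hk.lt_or_eq with h | rfl
  · have h1 : ((n.choose (k + 1) : ℕ) : ℝ) * (k + 1) = n.choose k * (n - k) := by
      have := Nat.choose_succ_right_eq n k
      rw [← Nat.cast_sub hk]
      exact_mod_cast this
    have hkn : (k : ℝ) + 1 ≤ n := by exact_mod_cast h
    have h2 : Real.Gamma (α + (k + 1 : ℕ) + 1) = (α + k + 1) * Real.Gamma (α + k + 1) := by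
      rw [← Real.Gamma_add_one (by linarith)]
      push_cast
      ring_nf
    have h3 : Real.Gamma (α + n - k + 1) = (α + n - k) * Real.Gamma (α + n - (k + 1 : ℕ) + 1) := by
      rw [Real.Gamma_add_one (by linarith)]
      push_cast
      ring_nf
    rw [alphaCoef_eq, alphaCoef_eq, h2, h3]
    linear_combination (α + k + 1) * Real.Gamma (α + k + 1) * (α + n - k) *
      Real.Gamma (α + n - (k + 1 : ℕ) + 1) /
        (Real.Gamma (n + 2 * α + 2) * ProbabilityTheory.beta (α + 1) (α + 1)) * h1
  · simp [alphaCoef]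

/-- Both sums over `k` that occur below are Chu–Vandermonde convolutions with the sequence
`Γ(α + 1 + j)`. -/
theorem sum_choose_mul_mul_Gamma {α x : ℝ} (hα : -1 / 2 < α) {e : ℕ → ℝ}
    (he : ∀ k, e (k + 1) = (k + x) * e k) (n : ℕ) :
    ∑ k ∈ Finset.range (n + 1), (n.choose k : ℝ) * (e k * Real.Gamma (α + n - k + 1)) =
      (∏ i ∈ Finset.range n, (x + (α + 1) + i)) * (e 0 * Real.Gamma (α + 1)) := by
  have hG : ∀ k : ℕ, Real.Gamma (α + 1 + (k + 1 : ℕ)) =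
      (k + (α + 1)) * Real.Gamma (α + 1 + k) := by
    intro k
    have hk0 : (0 : ℝ) ≤ k := by positivity
    rw [show α + 1 + ((k + 1 : ℕ) : ℝ) = (k + (α + 1)) + 1 by push_cast; ring,
      Real.Gamma_add_one (by linarith), add_comm (k : ℝ)]
  have h : ∀ n : ℕ, ∑ k ∈ Finset.range (n + 1), (n.choose k : ℝ) *
      (e k * Real.Gamma (α + 1 + (n - k : ℕ))) =
      (∏ i ∈ Finset.range n, (x + (α + 1) + i)) * (e 0 * Real.Gamma (α + 1)) := by
    intro n
    induction n with
    | zero => simp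
    | succ n ih =>
      rw [sum_choose_mul_succ (f := fun k => Real.Gamma (α + 1 + k)) he hG, ih,
        Finset.prod_range_succ]
      ring
  rw [← h n]
  refine Finset.sum_congr rfl fun k hk => ?_
  rw [Nat.cast_sub (Nat.lt_succ_iff.mp (Finset.mem_range.mp hk))]
  ring_nf

theorem Gamma_add_natCast {s : ℝ} (hs : 0 < s) (n : ℕ) :
    Real.Gamma (s + n) = (∏ i ∈ Finset.range n, (s + i)) * Real.Gamma s := by
  induction n with
  | zero => simp
  | succ n ih =>
    have hk0 : (0 : ℝ) ≤ n := by positivity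
    rw [Finset.prod_range_succ, Nat.cast_succ, ← add_assoc, Real.Gamma_add_one (by linarith), ih]
    ring

theorem sum_alphaCoef {α : ℝ} (hα : -1 / 2 < α) (n : ℕ) :
    ∑ k ∈ Finset.range (n + 1), alphaCoef α n k = 1 := by
  have h := sum_choose_mul_mul_Gamma hα (x := α + 1) (e := fun k => Real.Gamma (α + k + 1))
    (fun k => ?_) n
  · simp only [alphaCoef_eq]
    rw [← Finset.sum_div, h, ProbabilityTheory.beta,
      show (n : ℝ) + 2 * α + 2 = (α + 1 + (α + 1)) + n by ring, Gamma_add_natCast (by linarith)]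
    have h1 : 0 < Real.Gamma (α + 1) := Real.Gamma_pos_of_pos (by linarith)
    have h2 : 0 < Real.Gamma (α + 1 + (α + 1)) := Real.Gamma_pos_of_pos (by linarith)
    have h3 : 0 < ∏ i ∈ Finset.range n, (α + 1 + (α + 1) + (i : ℝ)) :=
      Finset.prod_pos fun i _ => by
        have hk0 : (0 : ℝ) ≤ i := by positivity
        linarith
    rw [Nat.cast_zero, add_zero]
    generalize ∏ i ∈ Finset.range n, (α + 1 + (α + 1) + (i : ℝ)) = p at h3 ⊢
    generalize Real.Gamma (α + 1 + (α + 1)) = q at h2 ⊢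
    field_simp
  · have hk0 : (0 : ℝ) ≤ k := by positivity
    rw [show (k : ℝ) + (α + 1) = α + k + 1 by ring, ← Real.Gamma_add_one (by linarith)]
    push_cast
    ring_nf

theorem covAlpha_neg (α : ℝ) (k : ℤ) : covAlpha α (-k) = covAlpha α k := by
  simp [covAlpha]

theorem sum_alphaCoef_mul_covAlpha_zero {α : ℝ} (hα : -1 / 2 < α) (n : ℕ) :
    ∑ k ∈ Finset.range (n + 1), alphaCoef α n k * covAlpha α (0 - k) = minVar α n := by
  have h := sum_choose_mul_mul_Gamma hα (x := -α)
    (e := fun k => Real.Gamma (α + k + 1) * covAlpha α k) (fun k => ?_) n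
  · have h1 : 0 < Real.Gamma (α + 1) := Real.Gamma_pos_of_pos (by linarith)
    have h2 : ∏ i ∈ Finset.range n, (-α + (α + 1) + (i : ℝ)) = n.factorial := by
      rw [← Finset.prod_range_add_one_eq_factorial]
      push_cast
      exact Finset.prod_congr rfl fun i _ => by ring
    rw [h2, Nat.cast_zero, Nat.cast_zero, add_zero, covAlpha_zero hα] at h
    rw [minVar]
    calc _ = (∑ k ∈ Finset.range (n + 1), (n.choose k : ℝ) *
          (Real.Gamma (α + k + 1) * covAlpha α k * Real.Gamma (α + n - k + 1))) /
          (Real.Gamma (n + 2 * α + 2) * ProbabilityTheory.beta (α + 1) (α + 1)) := by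
          rw [Finset.sum_div]
          refine Finset.sum_congr rfl fun k _ => ?_
          rw [zero_sub, covAlpha_neg, alphaCoef_eq]
          ring
      _ = _ := by
          rw [h]
          field_simp
  · have hk0 : (0 : ℝ) ≤ k := by positivity
    have h1 : Real.Gamma (α + (k + 1 : ℕ) + 1) = (α + k + 1) * Real.Gamma (α + k + 1) := by
      rw [← Real.Gamma_add_one (by linarith)]
      push_cast
      ring_nf
    have h2 := covAlpha_succ hα k
    rw [h1]
    push_cast at h2 ⊢
    linear_combination Real.Gamma (α + k + 1) * h2

/-- The normal equations for the weights `c_k(n, α)`: all covariances of `∑ c_k(n, α) X(k)` with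
`X(0), …, X(n)` are the same. -/
theorem sum_alphaCoef_mul_covAlpha {α : ℝ} (hα : -1 / 2 < α) (n : ℕ) {j : ℕ} (hj : j ≤ n) :
    ∑ k ∈ Finset.range (n + 1), alphaCoef α n k * covAlpha α (j - k) = minVar α n := by
  induction j with
  | zero => simpa using sum_alphaCoef_mul_covAlpha_zero hα n
  | succ j ih =>
    rw [← ih (by omega), ← sub_eq_zero, ← Finset.sum_sub_distrib]
    rw [← sum_mul_shift_eq_zero hα (δ := fun m => covAlpha α (m + 1) - covAlpha α m)
      (u := alphaCoef α n) (n := n) (fun k hk => alphaCoef_recurrence hα hk) (fun m => ?_) j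
      (by omega)]
    · refine Finset.sum_congr rfl fun k _ => ?_
      push_cast
      rw [show (j : ℤ) + 1 - k = j - k + 1 by ring]
      ring
    · have h1 := covAlpha_succ hα m
      have h2 := covAlpha_succ hα (m + 1)
      push_cast at h2
      linear_combination h2 - h1

theorem tendsto_rpow_mul_minVar {α : ℝ} (hα : -1 / 2 < α) :
    Tendsto (fun n : ℕ => (n : ℝ) ^ (2 * α + 1) * minVar α n) atTop
      (𝓝 (Real.Gamma (2 * α + 1) / ProbabilityTheory.beta (α + 1) (α + 1))) := by
  refine ((Real.GammaSeq_tendsto_Gamma (2 * α + 1)).div_const _).congr fun n => ?_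
  have h1 := Gamma_add_natCast (s := 2 * α + 1) (by linarith) (n + 1)
  have h2 : 0 < Real.Gamma (2 * α + 1) := Real.Gamma_pos_of_pos (by linarith)
  have h3 : 0 < ∏ i ∈ Finset.range (n + 1), (2 * α + 1 + (i : ℝ)) :=
    Finset.prod_pos fun i _ => by
      have hk0 : (0 : ℝ) ≤ i := by positivity
      linarith
  rw [Real.GammaSeq, minVar, show (n : ℝ) + 2 * α + 2 = 2 * α + 1 + (n + 1 : ℕ) by push_cast; ring,
    h1]
  have := beta_add_one_pos hα
  field_simp

/-! ### The quadratic form of a spectral density -/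

theorem fAlpha_eq (α x : ℝ) :
    fAlpha α x = (2 * Real.pi)⁻¹ * |2 * Real.sin (x / 2)| ^ (2 * α) := by
  rw [fAlpha, norm_sub_rev, Complex.norm_exp_I_mul_ofReal_sub_one, Real.norm_eq_abs]

theorem fAlpha_nonneg (α x : ℝ) : 0 ≤ fAlpha α x := by
  rw [fAlpha_eq]
  have := Real.pi_pos
  positivity

theorem fAlpha_neg (α x : ℝ) : fAlpha α (-x) = fAlpha α x := by
  rw [fAlpha_eq, fAlpha_eq, neg_div, Real.sin_neg, mul_neg, abs_neg]

theorem fAlpha_of_mem {α x : ℝ} (hx : x ∈ uIcc 0 Real.pi) :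
    fAlpha α x = (2 * Real.pi)⁻¹ * (2 * Real.sin (x / 2)) ^ (2 * α) := by
  rw [uIcc_of_le Real.pi_pos.le] at hx
  rw [fAlpha_eq, abs_of_nonneg]
  exact mul_nonneg zero_le_two (Real.sin_nonneg_of_nonneg_of_le_pi (by linarith [hx.1])
    (by linarith [hx.2, Real.pi_pos]))

theorem fAlpha_pos {α x : ℝ} (hx : x ∈ Icc (-Real.pi) Real.pi) (hx0 : x ≠ 0) :
    0 < fAlpha α x := by
  rw [fAlpha_eq]
  have hs : Real.sin (x / 2) ≠ 0 := by
    intro h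
    have := (Real.sin_eq_zero_iff_of_lt_of_lt (by linarith [hx.1, Real.pi_pos])
      (by linarith [hx.2, Real.pi_pos])).mp h
    exact hx0 (by linarith)
  have := Real.pi_pos
  positivity

theorem intervalIntegrable_fAlpha {α : ℝ} (hα : -1 / 2 < α) :
    IntervalIntegrable (fAlpha α) volume (-Real.pi) Real.pi := by
  have h : IntervalIntegrable (fAlpha α) volume 0 Real.pi :=
    ((intervalIntegrable_two_mul_sin_half_rpow hα).const_mul (2 * Real.pi)⁻¹).congr
      (fun x hx => (fAlpha_of_mem (uIoc_subset_uIcc hx)).symm)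
  refine IntervalIntegrable.trans (b := 0) ?_ h
  rw [IntervalIntegrable.iff_comp_neg] at h
  simp only [fAlpha_neg, neg_zero] at h
  exact h.symm

theorem intervalIntegrable_exp_mul_ofReal {f : ℝ → ℝ} {a b : ℝ}
    (hf : IntervalIntegrable f volume a b) (k : ℤ) :
    IntervalIntegrable (fun x : ℝ => Complex.exp (Complex.I * k * x) * (f x : ℂ)) volume a b :=
  IntervalIntegrable.continuousOn_mul ⟨hf.1.ofReal, hf.2.ofReal⟩ (by fun_prop)

theorem integral_exp_mul_fAlpha {α : ℝ} (hα : -1 / 2 < α) (k : ℤ) :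
    ∫ x in (-Real.pi)..Real.pi, Complex.exp (Complex.I * k * x) * (fAlpha α x : ℂ) =
      covAlpha α k := by
  have hf := intervalIntegrable_fAlpha hα
  have hi : ∀ k : ℤ, IntervalIntegrable
      (fun x : ℝ => Complex.exp (Complex.I * k * x) * (fAlpha α x : ℂ)) volume
      (-Real.pi) Real.pi := fun k => intervalIntegrable_exp_mul_ofReal hf k
  have h0 : (0 : ℝ) ∈ uIcc (-Real.pi) Real.pi := by
    rw [uIcc_of_le (by linarith [Real.pi_pos])]
    exact ⟨by linarith [Real.pi_pos], Real.pi_pos.le⟩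
  have hl : uIcc (-Real.pi) 0 ⊆ uIcc (-Real.pi) Real.pi := uIcc_subset_uIcc_left h0
  have hr : uIcc 0 Real.pi ⊆ uIcc (-Real.pi) Real.pi := uIcc_subset_uIcc_right h0
  rw [← intervalIntegral.integral_add_adjacent_intervals ((hi k).mono_set hl)
    ((hi k).mono_set hr)]
  have h1 := intervalIntegral.integral_comp_neg (a := 0) (b := Real.pi)
    (fun x : ℝ => Complex.exp (Complex.I * k * x) * (fAlpha α x : ℂ))
  rw [neg_zero] at h1
  have h2 : (fun x : ℝ => Complex.exp (Complex.I * k * (-x : ℝ)) * (fAlpha α (-x) : ℂ)) =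
      fun x : ℝ => Complex.exp (Complex.I * (-k : ℤ) * x) * (fAlpha α x : ℂ) := by
    funext x
    rw [fAlpha_neg]
    push_cast
    ring_nf
  rw [h2] at h1
  rw [← h1, ← intervalIntegral.integral_add ((hi (-k)).mono_set hr) ((hi k).mono_set hr),
    covAlpha, ← intervalIntegral.integral_const_mul, ← intervalIntegral.integral_ofReal]
  refine intervalIntegral.integral_congr fun x hx => ?_
  have hpi : (Real.pi : ℂ) ≠ 0 := by exact_mod_cast Real.pi_pos.ne'
  rw [fAlpha_of_mem hx]
  push_cast
  rw [Complex.cos]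
  ring_nf

/-- The quadratic form `∫_{-π}^{π} |P(e^{ix})|² f(x) dx`: the variance of `∑ P_k Y(k)` when `Y` has
the spectral density `f`. -/
noncomputable def specForm (f : ℝ → ℝ) (P : Polynomial ℂ) : ℝ :=
  ∫ x in (-Real.pi)..Real.pi, ‖P.eval (Complex.exp (Complex.I * x))‖ ^ 2 * f x

theorem intervalIntegrable_specForm {f : ℝ → ℝ}
    (hf : IntervalIntegrable f volume (-Real.pi) Real.pi) (P : Polynomial ℂ) :
    IntervalIntegrable (fun x => ‖P.eval (Complex.exp (Complex.I * x))‖ ^ 2 * f x) volume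
      (-Real.pi) Real.pi :=
  hf.continuousOn_mul (by fun_prop)

/-- The polynomial `∑ c_k(n, α) z^k`. -/
noncomputable def alphaPoly (α : ℝ) (n : ℕ) : Polynomial ℂ :=
  ∑ k ∈ Finset.range (n + 1), Polynomial.C (alphaCoef α n k : ℂ) * Polynomial.X ^ k

theorem eval_alphaPoly (α : ℝ) (n : ℕ) (z : ℂ) :
    (alphaPoly α n).eval z = ∑ k ∈ Finset.range (n + 1), (alphaCoef α n k : ℂ) * z ^ k := by
  simp [alphaPoly, Polynomial.eval_finsetSum]

theorem eval_one_alphaPoly {α : ℝ} (hα : -1 / 2 < α) (n : ℕ) : (alphaPoly α n).eval 1 = 1 := by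
  rw [eval_alphaPoly]
  simp only [one_pow, mul_one]
  exact_mod_cast sum_alphaCoef hα n

theorem natDegree_alphaPoly_le (α : ℝ) (n : ℕ) : (alphaPoly α n).natDegree ≤ n :=
  Polynomial.natDegree_sum_le_of_forall_le _ _ fun _ hk =>
    (Polynomial.natDegree_C_mul_X_pow_le _ _).trans (Nat.lt_succ_iff.mp (Finset.mem_range.mp hk))

theorem exp_I_mul_pow_mul_conj_pow (x : ℝ) (j k : ℕ) :
    Complex.exp (Complex.I * x) ^ j * conj (Complex.exp (Complex.I * x) ^ k) =
      Complex.exp (Complex.I * ((j - k : ℤ) : ℂ) * x) := by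
  rw [map_pow, ← Complex.exp_conj, ← Complex.exp_nat_mul, ← Complex.exp_nat_mul,
    ← Complex.exp_add]
  congr 1
  simp
  ring

/-- Up to the factor `V = minVar α n`, the polynomial `∑ c_k(n, α) z^k` is the reproducing kernel at
`z = 1` of the polynomials of degree at most `n` with the inner product of `L²(f_α)`. -/
theorem integral_mul_conj_alphaPoly {α : ℝ} (hα : -1 / 2 < α) {n : ℕ} {P : Polynomial ℂ}
    (hP : P.natDegree ≤ n) :
    ∫ x in (-Real.pi)..Real.pi, P.eval (Complex.exp (Complex.I * x)) *
        conj ((alphaPoly α n).eval (Complex.exp (Complex.I * x))) * (fAlpha α x : ℂ) =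
      P.eval 1 * minVar α n := by
  have hi : ∀ k : ℤ, IntervalIntegrable
      (fun x : ℝ => Complex.exp (Complex.I * k * x) * (fAlpha α x : ℂ)) volume
      (-Real.pi) Real.pi :=
    fun k => intervalIntegrable_exp_mul_ofReal (intervalIntegrable_fAlpha hα) k
  have h1 : ∀ x : ℝ, P.eval (Complex.exp (Complex.I * x)) *
        conj ((alphaPoly α n).eval (Complex.exp (Complex.I * x))) * (fAlpha α x : ℂ) =
      ∑ j ∈ Finset.range (n + 1), ∑ k ∈ Finset.range (n + 1), P.coeff j * alphaCoef α n k *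
        (Complex.exp (Complex.I * ((j - k : ℤ) : ℂ) * x) * (fAlpha α x : ℂ)) := by
    intro x
    rw [Polynomial.eval_eq_sum_range' (Nat.lt_succ_of_le hP), eval_alphaPoly, map_sum,
      Finset.sum_mul_sum, Finset.sum_mul]
    refine Finset.sum_congr rfl fun j _ => ?_
    rw [Finset.sum_mul]
    refine Finset.sum_congr rfl fun k _ => ?_
    rw [← exp_I_mul_pow_mul_conj_pow, map_mul, Complex.conj_ofReal]
    ring
  have hsum : ∀ j : ℕ, IntervalIntegrable (fun x : ℝ => ∑ k ∈ Finset.range (n + 1),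
      P.coeff j * alphaCoef α n k *
        (Complex.exp (Complex.I * ((j - k : ℤ) : ℂ) * x) * (fAlpha α x : ℂ))) volume
      (-Real.pi) Real.pi := by
    intro j
    have := IntervalIntegrable.sum (Finset.range (n + 1)) fun k _ =>
      (hi (j - k)).const_mul (P.coeff j * alphaCoef α n k : ℂ)
    simpa only [Finset.sum_fn] using this
  simp only [h1]
  rw [intervalIntegral.integral_finsetSum
    (fun j _ => hsum j),
    Polynomial.eval_eq_sum_range' (Nat.lt_succ_of_le hP), Finset.sum_mul]
  refine Finset.sum_congr rfl fun j hj => ?_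
  rw [intervalIntegral.integral_finsetSum
      (fun (k : ℕ) _ => (hi ((j : ℤ) - (k : ℤ))).const_mul (P.coeff j * alphaCoef α n k : ℂ)),
    ← sum_alphaCoef_mul_covAlpha hα n (Nat.lt_succ_iff.mp (Finset.mem_range.mp hj))]
  rw [Complex.ofReal_sum, Finset.mul_sum]
  refine Finset.sum_congr rfl fun k _ => ?_
  rw [intervalIntegral.integral_const_mul, integral_exp_mul_fAlpha hα, Complex.ofReal_mul]
  ring

theorem specForm_alphaPoly {α : ℝ} (hα : -1 / 2 < α) (n : ℕ) :
    specForm (fAlpha α) (alphaPoly α n) = minVar α n := by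
  have h := integral_mul_conj_alphaPoly hα (natDegree_alphaPoly_le α n)
  rw [eval_one_alphaPoly hα, one_mul] at h
  rw [specForm, ← Complex.ofReal_inj, ← h, ← intervalIntegral.integral_ofReal]
  refine intervalIntegral.integral_congr fun x _ => ?_
  rw [Complex.mul_conj, Complex.normSq_eq_norm_sq]
  push_cast
  ring

/-- Among the polynomials of degree at most `n` with a given value at `1`, the multiples of
`∑ c_k(n, α) z^k` minimize the quadratic form of `f_α`. -/
theorem minVar_mul_le_specForm {α : ℝ} (hα : -1 / 2 < α) {n : ℕ} {P : Polynomial ℂ}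
    (hP : P.natDegree ≤ n) :
    ‖P.eval 1‖ ^ 2 * minVar α n ≤ specForm (fAlpha α) P := by
  have hf := intervalIntegrable_fAlpha hα
  set w := P.eval 1 with hw
  set p := alphaPoly α n with hp
  have hcross : IntervalIntegrable (fun x : ℝ => P.eval (Complex.exp (Complex.I * x)) *
        conj (p.eval (Complex.exp (Complex.I * x))) * (fAlpha α x : ℂ)) volume
      (-Real.pi) Real.pi := by
    refine IntervalIntegrable.continuousOn_mul ⟨hf.1.ofReal, hf.2.ofReal⟩
      (ContinuousOn.mul (by fun_prop) ?_)
    exact (Complex.continuous_conj.comp (by fun_prop)).continuousOn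
  have hre : ∫ x in (-Real.pi)..Real.pi, (conj w * (P.eval (Complex.exp (Complex.I * x)) *
        conj (p.eval (Complex.exp (Complex.I * x))) * (fAlpha α x : ℂ))).re =
      ‖w‖ ^ 2 * minVar α n := by
    have h := Complex.reCLM.intervalIntegral_comp_comm (hcross.const_mul (conj w))
    simp only [Complex.reCLM_apply] at h
    rw [h, intervalIntegral.integral_const_mul, integral_mul_conj_alphaPoly hα hP, ← mul_assoc,
      mul_comm (conj w), ← hw, Complex.mul_conj, Complex.normSq_eq_norm_sq, ← Complex.ofReal_mul,
      Complex.ofReal_re]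
  have hrei : IntervalIntegrable (fun x : ℝ => (conj w * (P.eval (Complex.exp (Complex.I * x)) *
        conj (p.eval (Complex.exp (Complex.I * x))) * (fAlpha α x : ℂ))).re) volume
      (-Real.pi) Real.pi := by
    have := hcross.const_mul (conj w)
    exact ⟨this.1.re, this.2.re⟩
  have hnn : 0 ≤ ∫ x in (-Real.pi)..Real.pi, ‖P.eval (Complex.exp (Complex.I * x)) -
      w * p.eval (Complex.exp (Complex.I * x))‖ ^ 2 * fAlpha α x :=
    intervalIntegral.integral_nonneg (by linarith [Real.pi_pos])
      fun x _ => mul_nonneg (by positivity) (fAlpha_nonneg α x)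
  have hexp : ∀ x : ℝ, ‖P.eval (Complex.exp (Complex.I * x)) -
      w * p.eval (Complex.exp (Complex.I * x))‖ ^ 2 * fAlpha α x =
      ‖P.eval (Complex.exp (Complex.I * x))‖ ^ 2 * fAlpha α x -
        2 * (conj w * (P.eval (Complex.exp (Complex.I * x)) *
        conj (p.eval (Complex.exp (Complex.I * x))) * (fAlpha α x : ℂ))).re +
        ‖w‖ ^ 2 * (‖p.eval (Complex.exp (Complex.I * x))‖ ^ 2 * fAlpha α x) := by
    intro x
    simp only [← Complex.normSq_eq_norm_sq, Complex.normSq_apply, Complex.sub_re, Complex.sub_im,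
      Complex.mul_re, Complex.mul_im, Complex.conj_re, Complex.conj_im, Complex.ofReal_re,
      Complex.ofReal_im]
    ring
  simp only [hexp] at hnn
  rw [intervalIntegral.integral_add ((intervalIntegrable_specForm hf P).sub (hrei.const_mul 2))
      ((intervalIntegrable_specForm hf p).const_mul _),
    intervalIntegral.integral_sub (intervalIntegrable_specForm hf P) (hrei.const_mul 2),
    intervalIntegral.integral_const_mul, intervalIntegral.integral_const_mul, hre] at hnn
  have h1 := specForm_alphaPoly hα n
  rw [specForm, ← hp] at h1
  rw [h1] at hnn
  rw [specForm]
  linarith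

/-! ### Decay of `∑ c_k(n, α) z^k` away from `z = 1` -/

theorem alphaCoef_mul_beta {α : ℝ} (hα : -1 / 2 < α) {n k : ℕ} (hk : k ≤ n) :
    alphaCoef α n k * ProbabilityTheory.beta (α + 1) (α + 1) =
      ∫ t in Ioo (0 : ℝ) 1, (n.choose k : ℝ) * ((t ^ α * (1 - t) ^ α) * (t ^ k * (1 - t) ^ (n - k)))
      ∧ IntegrableOn (fun t : ℝ => (n.choose k : ℝ) *
      ((t ^ α * (1 - t) ^ α) * (t ^ k * (1 - t) ^ (n - k)))) (Ioo 0 1) := by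
  have hk0 : (0 : ℝ) ≤ k := by positivity
  have hkn : (k : ℝ) ≤ n := by exact_mod_cast hk
  have ha : 0 < α + k + 1 := by linarith
  have hb : 0 < α + n - k + 1 := by linarith
  have hcongr : ∀ t ∈ Ioo (0 : ℝ) 1, (n.choose k : ℝ) *
      (t ^ (α + k + 1 - 1) * (1 - t) ^ (α + n - k + 1 - 1)) = (n.choose k : ℝ) *
      ((t ^ α * (1 - t) ^ α) * (t ^ k * (1 - t) ^ (n - k))) := by
    intro t ht
    have h1 : 0 < 1 - t := by linarith [ht.2]
    rw [add_sub_cancel_right, add_sub_cancel_right, Real.rpow_add_natCast ht.1.ne', add_sub_assoc,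
      ← Nat.cast_sub hk, Real.rpow_add_natCast h1.ne']
    ring
  constructor
  · rw [← setIntegral_congr_fun measurableSet_Ioo hcongr, integral_const_mul,
      integral_rpow_mul_one_sub_rpow ha hb, alphaCoef,
      div_mul_cancel₀ _ (beta_add_one_pos hα).ne']
  · exact IntegrableOn.congr_fun
      ((integrableOn_rpow_mul_one_sub_rpow ha hb).integrable.const_mul _) hcongr measurableSet_Ioo

/-- The weights `c_k(n, α)` are the means of the binomial probabilities over a symmetric Beta
distribution of the success probability. -/
theorem eval_alphaPoly_mul_beta {α : ℝ} (hα : -1 / 2 < α) (n : ℕ) (z : ℂ) :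
    (alphaPoly α n).eval z * ProbabilityTheory.beta (α + 1) (α + 1) =
      ∫ t in Ioo (0 : ℝ) 1, ((t ^ α * (1 - t) ^ α : ℝ) : ℂ) * (t * z + (1 - t)) ^ n := by
  have h1 : ∀ t ∈ Ioo (0 : ℝ) 1, ((t ^ α * (1 - t) ^ α : ℝ) : ℂ) * (t * z + (1 - t)) ^ n =
      ∑ k ∈ Finset.range (n + 1), (((n.choose k : ℝ) *
        ((t ^ α * (1 - t) ^ α) * (t ^ k * (1 - t) ^ (n - k))) : ℝ) : ℂ) * z ^ k := by
    intro t _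
    rw [add_pow, Finset.mul_sum]
    refine Finset.sum_congr rfl fun k _ => ?_
    push_cast
    ring
  have hi : ∀ k ∈ Finset.range (n + 1), IntegrableOn (fun t : ℝ => (((n.choose k : ℝ) *
        ((t ^ α * (1 - t) ^ α) * (t ^ k * (1 - t) ^ (n - k))) : ℝ) : ℂ) * z ^ k) (Ioo 0 1) :=
    fun k hk => ((alphaCoef_mul_beta hα
      (Nat.lt_succ_iff.mp (Finset.mem_range.mp hk))).2.ofReal (𝕜 := ℂ)).mul_const _
  rw [setIntegral_congr_fun measurableSet_Ioo h1, integral_finsetSum _ hi, eval_alphaPoly,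
    Finset.sum_mul]
  refine Finset.sum_congr rfl fun k hk => ?_
  rw [integral_mul_const, integral_complex_ofReal, ← (alphaCoef_mul_beta hα
      (Nat.lt_succ_iff.mp (Finset.mem_range.mp hk))).1]
  push_cast
  ring

/-- From `|1 - t + t z|² = 1 - t (1 - t) |1 - z|²` for `|z| = 1`. -/
theorem norm_convex_comb_one_pow_le {z : ℂ} (hz : ‖z‖ = 1) {s t : ℝ} (hs : 0 ≤ s)
    (hsz : s ≤ ‖1 - z‖) (ht : t ∈ Ioo (0 : ℝ) 1) (n : ℕ) :
    ‖(t : ℂ) * z + (1 - t)‖ ^ n ≤ Real.exp (-(n * s ^ 2 / 2) * (t * (1 - t))) := by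
  have ht1 : 0 < 1 - t := by linarith [ht.2]
  have h1 : ‖(t : ℂ) * z + (1 - t)‖ ^ 2 = 1 - t * (1 - t) * ‖1 - z‖ ^ 2 := by
    have hz2 : z.re * z.re + z.im * z.im = 1 := by
      rw [← Complex.normSq_apply, Complex.normSq_eq_norm_sq, hz, one_pow]
    simp only [← Complex.normSq_eq_norm_sq, Complex.normSq_apply, Complex.add_re, Complex.add_im,
      Complex.mul_re, Complex.mul_im, Complex.sub_re, Complex.sub_im, Complex.one_re,
      Complex.one_im, Complex.ofReal_re, Complex.ofReal_im]
    linear_combination t * hz2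
  have h2 : ‖(t : ℂ) * z + (1 - t)‖ ^ 2 ≤ Real.exp (-(s ^ 2) * (t * (1 - t))) := by
    rw [h1]
    have h3 : s ^ 2 ≤ ‖1 - z‖ ^ 2 := by gcongr
    have h4 := Real.add_one_le_exp (-(s ^ 2) * (t * (1 - t)))
    have h5 : 0 < t * (1 - t) := mul_pos ht.1 ht1
    nlinarith
  have h3 : ‖(t : ℂ) * z + (1 - t)‖ ≤ Real.exp (-(s ^ 2 / 2) * (t * (1 - t))) := by
    refine le_of_sq_le_sq ?_ (Real.exp_pos _).le
    refine h2.trans_eq ?_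
    rw [← Real.exp_nat_mul]
    congr 1
    push_cast
    ring
  calc _ ≤ Real.exp (-(s ^ 2 / 2) * (t * (1 - t))) ^ n := by gcongr
    _ = _ := by
      rw [← Real.exp_nat_mul]
      congr 1
      ring

theorem rpow_le_two_of_half_le {α y : ℝ} (hα : -1 / 2 < α) (hy : 1 / 2 ≤ y) (hy1 : y ≤ 1) :
    y ^ α ≤ 2 := by
  have hy0 : 0 < y := by linarith
  calc y ^ α ≤ y ^ (-1 : ℝ) := Real.rpow_le_rpow_of_exponent_ge hy0 hy1 (by linarith)
    _ = y⁻¹ := Real.rpow_neg_one y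
    _ ≤ (1 / 2 : ℝ)⁻¹ := by gcongr
    _ = 2 := by norm_num

theorem beta_weight_mul_exp_le {α c t : ℝ} (hα : -1 / 2 < α) (hc : 0 ≤ c)
    (ht : t ∈ Ioo (0 : ℝ) 1) :
    t ^ α * (1 - t) ^ α * Real.exp (-(2 * c) * (t * (1 - t))) ≤
      2 * (t ^ α * Real.exp (-(c * t))) + 2 * ((1 - t) ^ α * Real.exp (-(c * (1 - t)))) := by
  -- the first factor of the symmetric weight is the relevant one on the left half
  have key : ∀ t : ℝ, 0 < t → t ≤ 1 / 2 →
      t ^ α * (1 - t) ^ α * Real.exp (-(2 * c) * (t * (1 - t))) ≤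
        2 * (t ^ α * Real.exp (-(c * t))) := by
    intro t ht0 ht1
    have h1 := rpow_le_two_of_half_le hα (y := 1 - t) (by linarith) (by linarith)
    have h2 : Real.exp (-(2 * c) * (t * (1 - t))) ≤ Real.exp (-(c * t)) := by
      refine Real.exp_le_exp.mpr ?_
      have : 0 ≤ c * t * (1 - 2 * t) := by
        have : 0 ≤ 1 - 2 * t := by linarith
        positivity
      nlinarith
    have h3 : 0 ≤ t ^ α := by positivity
    calc _ ≤ t ^ α * 2 * Real.exp (-(c * t)) := by gcongr
      _ = _ := by ring
  have ht1 : 0 < 1 - t := by linarith [ht.2]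
  have ht0 := ht.1
  rcases le_total t (1 / 2) with h | h
  · have := key t ht0 h
    have h2 : 0 ≤ 2 * ((1 - t) ^ α * Real.exp (-(c * (1 - t)))) := by positivity
    linarith
  · have := key (1 - t) ht1 (by linarith)
    rw [sub_sub_cancel, mul_comm ((1 - t) ^ α), mul_comm (1 - t) t] at this
    have h2 : 0 ≤ 2 * (t ^ α * Real.exp (-(c * t))) := by positivity
    linarith

theorem integrableOn_rpow_mul_exp_neg_mul {α c : ℝ} (hα : -1 / 2 < α) (hc : 0 < c) :
    IntegrableOn (fun t : ℝ => t ^ α * Real.exp (-(c * t))) (Ioi 0) := by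
  have h := integrableOn_rpow_mul_exp_neg_mul_rpow (s := α) (p := 1) (b := c) (by linarith)
    one_pos hc
  simpa using h

theorem integral_rpow_mul_exp_neg_mul_le {α c : ℝ} (hα : -1 / 2 < α) (hc : 0 < c) :
    ∫ t in Ioo (0 : ℝ) 1, t ^ α * Real.exp (-(c * t)) ≤
      (1 / c) ^ (α + 1) * Real.Gamma (α + 1) := by
  rw [← Real.integral_rpow_mul_exp_neg_mul_Ioi (by linarith) hc, add_sub_cancel_right]
  refine setIntegral_mono_set (integrableOn_rpow_mul_exp_neg_mul hα hc) ?_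
    Ioo_subset_Ioi_self.eventuallyLE
  filter_upwards [ae_restrict_mem measurableSet_Ioi] with t ht
  have : (0 : ℝ) < t := ht
  simp only [Pi.zero_apply]
  positivity

/-- In the Beta mean of `(1 - t + t z)^n` only `t` within `O(1 / n)` of `0` or `1` contribute, which
have mass of order `n^{-α-1}`. -/
theorem norm_eval_alphaPoly_le {α : ℝ} (hα : -1 / 2 < α) {s : ℝ} (hs : 0 < s) :
    ∃ C : ℝ, ∀ n : ℕ, 0 < n → ∀ z : ℂ, ‖z‖ = 1 → s ≤ ‖1 - z‖ →
      ‖(alphaPoly α n).eval z‖ ≤ C * (n : ℝ) ^ (-(α + 1)) := by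
  have hB := beta_add_one_pos hα
  refine ⟨4 * ((4 / s ^ 2) ^ (α + 1) * Real.Gamma (α + 1)) /
    ProbabilityTheory.beta (α + 1) (α + 1), fun n hn z hz hsz => ?_⟩
  have hn' : (0 : ℝ) < n := by exact_mod_cast hn
  set c : ℝ := n * s ^ 2 / 4 with hc
  have hc0 : 0 < c := by positivity
  set φ : ℝ → ℝ := fun t => t ^ α * Real.exp (-(c * t)) with hφ
  have hφi : IntervalIntegrable φ volume 0 1 := by
    rw [intervalIntegrable_iff_integrableOn_Ioo_of_le zero_le_one]
    exact (integrableOn_rpow_mul_exp_neg_mul hα hc0).mono_set Ioo_subset_Ioi_self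
  have hφi' : IntervalIntegrable (fun t => φ (1 - t)) volume 0 1 := by
    have := hφi.comp_sub_left 1
    simp only [sub_zero, sub_self] at this
    exact this.symm
  have hint : ‖(alphaPoly α n).eval z * ProbabilityTheory.beta (α + 1) (α + 1)‖ ≤
      ∫ t in Ioo (0 : ℝ) 1, (2 * φ t + 2 * φ (1 - t)) := by
    rw [eval_alphaPoly_mul_beta hα]
    refine norm_integral_le_of_norm_le ?_ ?_
    · rw [intervalIntegrable_iff_integrableOn_Ioo_of_le zero_le_one] at hφi hφi'
      exact (hφi.integrable.const_mul 2).add (hφi'.integrable.const_mul 2)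
    · filter_upwards [ae_restrict_mem measurableSet_Ioo] with t ht
      have ht1 : 0 < 1 - t := by linarith [ht.2]
      have ht0 := ht.1
      have h1 := norm_convex_comb_one_pow_le hz hs.le hsz ht n
      rw [show (n : ℝ) * s ^ 2 / 2 = 2 * c by rw [hc]; ring] at h1
      rw [norm_mul, norm_pow, Complex.norm_real, Real.norm_of_nonneg (by positivity)]
      calc _ ≤ t ^ α * (1 - t) ^ α * Real.exp (-(2 * c) * (t * (1 - t))) := by gcongr
        _ ≤ _ := beta_weight_mul_exp_le hα hc0.le ht
  have hval : ∫ t in Ioo (0 : ℝ) 1, (2 * φ t + 2 * φ (1 - t)) ≤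
      4 * ((1 / c) ^ (α + 1) * Real.Gamma (α + 1)) := by
    rw [← integral_Ioc_eq_integral_Ioo, ← intervalIntegral.integral_of_le zero_le_one,
      intervalIntegral.integral_add (hφi.const_mul 2) (hφi'.const_mul 2),
      intervalIntegral.integral_const_mul, intervalIntegral.integral_const_mul,
      intervalIntegral.integral_comp_sub_left φ 1, sub_self, sub_zero,
      intervalIntegral.integral_of_le zero_le_one, integral_Ioc_eq_integral_Ioo]
    have := integral_rpow_mul_exp_neg_mul_le hα hc0
    linarith
  have hpow : (1 / c) ^ (α + 1) = (4 / s ^ 2) ^ (α + 1) * (n : ℝ) ^ (-(α + 1)) := by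
    rw [Real.rpow_neg hn'.le, ← Real.inv_rpow hn'.le, ← Real.mul_rpow (by positivity)
      (by positivity), hc]
    congr 1
    field_simp
  have h := hint.trans hval
  rw [norm_mul, Complex.norm_real, Real.norm_of_nonneg hB.le, hpow] at h
  rw [div_mul_eq_mul_div, le_div_iff₀ hB]
  linarith

/-! ### The variance of the estimator `m̂_α` -/

theorem le_norm_one_sub_exp {x : ℝ} (hx : x ∈ Icc (-Real.pi) Real.pi) :
    2 / Real.pi * |x| ≤ ‖1 - Complex.exp (Complex.I * x)‖ := by
  rw [norm_sub_rev, Complex.norm_exp_I_mul_ofReal_sub_one, Real.norm_eq_abs, abs_mul, abs_two]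
  have h := Real.mul_abs_le_abs_sin (x := x / 2) (by
    rw [abs_div, abs_two]
    exact div_le_div_of_nonneg_right (abs_le.mpr hx) zero_le_two)
  rw [abs_div, abs_two] at h
  linarith

/-- The mass of `|∑ c_k(n, α) e^{ikx}|² f_α(x)` concentrates at `x = 0`, so that only the value
`g(0)` matters asymptotically. -/
theorem tendsto_rpow_mul_specForm_alphaPoly {α : ℝ} (hα : -1 / 2 < α) {g : ℝ → ℝ}
    (hg : ContinuousAt g 0)
    (hfg : IntervalIntegrable (fun x => fAlpha α x * g x) volume (-Real.pi) Real.pi) :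
    Tendsto (fun n : ℕ => (n : ℝ) ^ (2 * α + 1) *
        specForm (fun x => fAlpha α x * g x) (alphaPoly α n)) atTop
      (𝓝 (g 0 * (Real.Gamma (2 * α + 1) / ProbabilityTheory.beta (α + 1) (α + 1)))) := by
  have hf := intervalIntegrable_fAlpha hα
  set L := Real.Gamma (2 * α + 1) / ProbabilityTheory.beta (α + 1) (α + 1) with hL
  have hL0 : 0 < L := div_pos (Real.Gamma_pos_of_pos (by linarith)) (beta_add_one_pos hα)
  have hdi : IntervalIntegrable (fun x => fAlpha α x * (g x - g 0)) volume (-Real.pi)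
      Real.pi := by
    simpa only [mul_sub] using hfg.sub (hf.mul_const (g 0))
  have hdi' : IntervalIntegrable (fun x => fAlpha α x * |g x - g 0|) volume (-Real.pi)
      Real.pi := by
    refine hdi.norm.congr fun x _ => ?_
    rw [norm_mul, Real.norm_of_nonneg (fAlpha_nonneg α x), Real.norm_eq_abs]
  have hpi : -Real.pi ≤ Real.pi := by linarith [Real.pi_pos]
  set D := ∫ x in (-Real.pi)..Real.pi, fAlpha α x * |g x - g 0| with hD
  have hV := tendsto_rpow_mul_minVar hα
  -- the error of replacing `g` by `g 0`
  have hE : Tendsto (fun n : ℕ => (n : ℝ) ^ (2 * α + 1) *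
      specForm (fun x => fAlpha α x * (g x - g 0)) (alphaPoly α n)) atTop (𝓝 0) := by
    rw [Metric.tendsto_atTop']
    intro ε hε
    obtain ⟨δ, hδ0, hδ⟩ := Metric.continuousAt_iff.mp hg (ε / (2 * (L + 1))) (by positivity)
    obtain ⟨C, hC⟩ := norm_eval_alphaPoly_le hα (s := 2 / Real.pi * δ)
      (mul_pos (div_pos two_pos Real.pi_pos) hδ0)
    have h1 : ∀ᶠ n : ℕ in atTop, (n : ℝ) ^ (2 * α + 1) * minVar α n < L + 1 :=
      hV.eventually_lt_const (by linarith)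
    have h2 : ∀ᶠ n : ℕ in atTop, C ^ 2 * D / (n : ℝ) < ε / 2 :=
      (tendsto_const_div_atTop_nhds_zero_nat _).eventually_lt_const (by linarith)
    obtain ⟨N, hN⟩ := eventually_atTop.mp (h1.and (h2.and (eventually_gt_atTop 0)))
    refine ⟨N, fun n hn => ?_⟩
    obtain ⟨hn1, hn2, hn0⟩ := hN n hn.le
    have hn' : (0 : ℝ) < n := by exact_mod_cast hn0
    have hpt : ∀ x ∈ Icc (-Real.pi) Real.pi,
        ‖‖(alphaPoly α n).eval (Complex.exp (Complex.I * x))‖ ^ 2 *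
          (fAlpha α x * (g x - g 0))‖ ≤
        ε / (2 * (L + 1)) * (‖(alphaPoly α n).eval (Complex.exp (Complex.I * x))‖ ^ 2 *
          fAlpha α x) + (C * (n : ℝ) ^ (-(α + 1))) ^ 2 * (fAlpha α x * |g x - g 0|) := by
      intro x hx
      have hfx := fAlpha_nonneg α x
      rw [norm_mul, norm_mul, Real.norm_of_nonneg hfx, Real.norm_eq_abs (g x - g 0),
        Real.norm_of_nonneg (by positivity)]
      rcases lt_or_ge |x| δ with h | h
      · have h3 : |g x - g 0| ≤ ε / (2 * (L + 1)) := by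
          have := hδ (x := x) (by simpa [Real.dist_eq] using h)
          rw [Real.dist_eq] at this
          exact this.le
        have h4 : 0 ≤ (C * (n : ℝ) ^ (-(α + 1))) ^ 2 * (fAlpha α x * |g x - g 0|) := by
          positivity
        have h5 : ‖(alphaPoly α n).eval (Complex.exp (Complex.I * x))‖ ^ 2 *
            (fAlpha α x * |g x - g 0|) ≤
            ‖(alphaPoly α n).eval (Complex.exp (Complex.I * x))‖ ^ 2 *
            (fAlpha α x * (ε / (2 * (L + 1)))) := by gcongr
        linarith
      · have h3 := hC n hn0 (Complex.exp (Complex.I * x))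
          (by rw [mul_comm]; exact Complex.norm_exp_ofReal_mul_I x)
          (le_trans (by have := Real.pi_pos; gcongr) (le_norm_one_sub_exp hx))
        have h4 : ‖(alphaPoly α n).eval (Complex.exp (Complex.I * x))‖ ^ 2 *
            (fAlpha α x * |g x - g 0|) ≤
            (C * (n : ℝ) ^ (-(α + 1))) ^ 2 * (fAlpha α x * |g x - g 0|) := by gcongr
        have h5 : 0 ≤ ε / (2 * (L + 1)) *
            (‖(alphaPoly α n).eval (Complex.exp (Complex.I * x))‖ ^ 2 * fAlpha α x) := by
          positivity
        linarith
    have hbd : ‖specForm (fun x => fAlpha α x * (g x - g 0)) (alphaPoly α n)‖ ≤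
        ε / (2 * (L + 1)) * minVar α n + (C * (n : ℝ) ^ (-(α + 1))) ^ 2 * D := by
      rw [← specForm_alphaPoly hα, hD, specForm, specForm, ← intervalIntegral.integral_const_mul,
        ← intervalIntegral.integral_const_mul, ← intervalIntegral.integral_add
          ((intervalIntegrable_specForm hf _).const_mul _) (hdi'.const_mul _)]
      refine intervalIntegral.norm_integral_le_of_norm_le hpi ?_
        (((intervalIntegrable_specForm hf _).const_mul _).add (hdi'.const_mul _))
      exact Eventually.of_forall fun x hx => hpt x (Ioc_subset_Icc_self hx)
    have hpow : (n : ℝ) ^ (2 * α + 1) * ((n : ℝ) ^ (-(α + 1))) ^ 2 = (n : ℝ)⁻¹ := by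
      rw [← Real.rpow_natCast, ← Real.rpow_mul hn'.le, ← Real.rpow_add hn', ← Real.rpow_neg_one]
      congr 1
      push_cast
      ring
    rw [dist_zero_right, norm_mul, Real.norm_of_nonneg (by positivity)]
    have hn2' : C ^ 2 * D * (n : ℝ)⁻¹ < ε / 2 := by rwa [← div_eq_mul_inv]
    calc _ ≤ (n : ℝ) ^ (2 * α + 1) *
          (ε / (2 * (L + 1)) * minVar α n + (C * (n : ℝ) ^ (-(α + 1))) ^ 2 * D) := by gcongr
      _ = ε / (2 * (L + 1)) * ((n : ℝ) ^ (2 * α + 1) * minVar α n) + C ^ 2 * D * (n : ℝ)⁻¹ := by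
        rw [← hpow]
        ring
      _ < ε / (2 * (L + 1)) * (L + 1) + ε / 2 := by gcongr
      _ = ε := by
        field_simp
        ring
  have hsum := (hV.const_mul (g 0)).add hE
  rw [add_zero] at hsum
  refine hsum.congr fun n => ?_
  have hsplit : specForm (fun x => fAlpha α x * g x) (alphaPoly α n) =
      g 0 * minVar α n + specForm (fun x => fAlpha α x * (g x - g 0)) (alphaPoly α n) := by
    rw [← specForm_alphaPoly hα, specForm, specForm, specForm,
      ← intervalIntegral.integral_const_mul, ← intervalIntegral.integral_add
        ((intervalIntegrable_specForm hf _).const_mul _) (intervalIntegrable_specForm hdi _)]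
    refine intervalIntegral.integral_congr fun x _ => ?_
    ring
  rw [hsplit]
  ring

/-! ### Trigonometric minorants and the lower bound -/

theorem norm_half_one_add_exp_sq_le {x : ℝ} (hx : x ∈ Icc (-Real.pi) Real.pi) :
    ‖(1 / 2 : ℂ) * (1 + Complex.exp (Complex.I * x))‖ ^ 2 ≤ 1 - (|x| / Real.pi) ^ 2 := by
  have h1 : ‖(1 / 2 : ℂ) * (1 + Complex.exp (Complex.I * x))‖ ^ 2 =
      1 - (‖1 - Complex.exp (Complex.I * x)‖ / 2) ^ 2 := by
    have h := parallelogram_law_with_norm ℝ (1 : ℂ) (Complex.exp (Complex.I * x))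
    have h2 : ‖Complex.exp (Complex.I * x)‖ = 1 := by
      rw [mul_comm]
      exact Complex.norm_exp_ofReal_mul_I x
    rw [h2, norm_one] at h
    rw [norm_mul, norm_div, norm_one, Complex.norm_ofNat]
    linear_combination h / 4
  rw [h1]
  have h2 := le_norm_one_sub_exp hx
  have hpi := Real.pi_pos
  have h3 : |x| / Real.pi ≤ ‖1 - Complex.exp (Complex.I * x)‖ / 2 := by
    rw [le_div_iff₀ two_pos]
    calc _ = 2 / Real.pi * |x| := by ring
      _ ≤ _ := h2
  have h4 : (|x| / Real.pi) ^ 2 ≤ (‖1 - Complex.exp (Complex.I * x)‖ / 2) ^ 2 := by gcongr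
  linarith

/-- A multiple of `r(z) ((1 + z) / 2)^N` with large `N` is a minorant which is almost optimal at
`z = 1`, because `|(1 + z) / 2| < 1` elsewhere on the unit circle. -/
theorem exists_polynomial_sq_le_of_le {g : ℝ → ℝ} {r : Polynomial ℂ} {κ t : ℝ} (hκ : 0 < κ)
    (hr1 : r.eval 1 ≠ 0)
    (hr : ∀ x ∈ Icc (-Real.pi) Real.pi, κ * ‖r.eval (Complex.exp (Complex.I * x))‖ ^ 2 ≤ g x)
    (hg : ContinuousAt g 0) (ht : 0 < t) (htg : t < g 0) :
    ∃ q : Polynomial ℂ, ‖q.eval 1‖ ^ 2 = t ∧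
      ∀ x ∈ Icc (-Real.pi) Real.pi, ‖q.eval (Complex.exp (Complex.I * x))‖ ^ 2 ≤ g x := by
  have hr0 : 0 < ‖r.eval 1‖ ^ 2 := by positivity
  have hcont : ContinuousAt
      (fun x : ℝ => t / ‖r.eval 1‖ ^ 2 * ‖r.eval (Complex.exp (Complex.I * x))‖ ^ 2) 0 := by
    fun_prop
  have hlt : ∀ᶠ x : ℝ in 𝓝 0,
      t / ‖r.eval 1‖ ^ 2 * ‖r.eval (Complex.exp (Complex.I * (x : ℝ)))‖ ^ 2 < g x := by
    refine hcont.eventually_lt hg ?_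
    simpa [div_mul_cancel₀ _ hr0.ne'] using htg
  obtain ⟨δ, hδ0, hδ⟩ := Metric.eventually_nhds_iff.mp hlt
  have hpi := Real.pi_pos
  set ρ : ℝ := max 0 (1 - (δ / Real.pi) ^ 2) with hρ
  have hρ0 : 0 ≤ ρ := le_max_left _ _
  have hρ1 : ρ < 1 := max_lt one_pos (by have : 0 < (δ / Real.pi) ^ 2 := by positivity
                                         linarith)
  obtain ⟨N, hN⟩ := exists_pow_lt_of_lt_one (div_pos (mul_pos hκ hr0) ht) hρ1
  have hN' : t / ‖r.eval 1‖ ^ 2 * ρ ^ N ≤ κ := by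
    rw [div_mul_eq_mul_div, div_le_iff₀ hr0]
    rw [lt_div_iff₀ ht] at hN
    linarith
  refine ⟨Polynomial.C ((√t / ‖r.eval 1‖ : ℝ) : ℂ) * r *
    (Polynomial.C (1 / 2) * (1 + Polynomial.X)) ^ N, ?_, fun x hx => ?_⟩
  · have h1 : ‖r.eval 1‖ ≠ 0 := norm_ne_zero_iff.mpr hr1
    simp only [Polynomial.eval_mul, Polynomial.eval_C, Polynomial.eval_pow, Polynomial.eval_add,
      Polynomial.eval_one, Polynomial.eval_X, norm_mul, norm_pow]
    rw [Complex.norm_real, Real.norm_of_nonneg (by positivity), div_mul_cancel₀ _ h1]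
    norm_num
    exact Real.sq_sqrt ht.le
  · have heval : ‖(Polynomial.C ((√t / ‖r.eval 1‖ : ℝ) : ℂ) * r *
        (Polynomial.C (1 / 2) * (1 + Polynomial.X)) ^ N).eval
          (Complex.exp (Complex.I * x))‖ ^ 2 =
        t / ‖r.eval 1‖ ^ 2 * ‖r.eval (Complex.exp (Complex.I * x))‖ ^ 2 *
          (‖(1 / 2 : ℂ) * (1 + Complex.exp (Complex.I * x))‖ ^ 2) ^ N := by
      simp only [Polynomial.eval_mul, Polynomial.eval_C, Polynomial.eval_pow,
        Polynomial.eval_add, Polynomial.eval_one, Polynomial.eval_X]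
      rw [norm_mul, norm_mul, norm_pow, Complex.norm_real, Real.norm_of_nonneg (by positivity),
        mul_pow, mul_pow, div_pow, Real.sq_sqrt ht.le]
      ring
    rw [heval]
    have hE := norm_half_one_add_exp_sq_le hx
    have hE0 : 0 ≤ ‖(1 / 2 : ℂ) * (1 + Complex.exp (Complex.I * x))‖ ^ 2 := by positivity
    rcases lt_or_ge |x| δ with h | h
    · have h1 := hδ (y := x) (by simpa [Real.dist_eq] using h)
      have h2 : (‖(1 / 2 : ℂ) * (1 + Complex.exp (Complex.I * x))‖ ^ 2) ^ N ≤ 1 := by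
        refine pow_le_one₀ hE0 (hE.trans ?_)
        have : 0 ≤ (|x| / Real.pi) ^ 2 := by positivity
        linarith
      exact (mul_le_of_le_one_right (by positivity) h2).trans h1.le
    · have h1 : ‖(1 / 2 : ℂ) * (1 + Complex.exp (Complex.I * x))‖ ^ 2 ≤ ρ := by
        refine (hE.trans ?_).trans (le_max_right _ _)
        have : (δ / Real.pi) ^ 2 ≤ (|x| / Real.pi) ^ 2 := by gcongr
        linarith
      have h2 : (‖(1 / 2 : ℂ) * (1 + Complex.exp (Complex.I * x))‖ ^ 2) ^ N ≤ ρ ^ N := by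
        gcongr
      calc _ ≤ t / ‖r.eval 1‖ ^ 2 * ‖r.eval (Complex.exp (Complex.I * x))‖ ^ 2 * ρ ^ N := by
            gcongr
        _ = t / ‖r.eval 1‖ ^ 2 * ρ ^ N * ‖r.eval (Complex.exp (Complex.I * x))‖ ^ 2 := by ring
        _ ≤ κ * ‖r.eval (Complex.exp (Complex.I * x))‖ ^ 2 := by gcongr
        _ ≤ g x := hr x hx

theorem norm_exp_sub_exp_le (x z : ℝ) :
    ‖Complex.exp (Complex.I * x) - Complex.exp (Complex.I * z)‖ ≤ |x - z| := by
  have h1 : Complex.exp (Complex.I * x) - Complex.exp (Complex.I * z) =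
      Complex.exp (z * Complex.I) * (Complex.exp (Complex.I * (x - z : ℝ)) - 1) := by
    rw [mul_sub, ← Complex.exp_add, mul_one, mul_comm (z : ℂ)]
    congr 2
    push_cast
    ring
  rw [h1, norm_mul, Complex.norm_exp_ofReal_mul_I, one_mul]
  exact Real.norm_exp_I_mul_ofReal_sub_one_le

theorem exp_I_mul_ne_one {z : ℝ} (hz : z ∈ Icc (-Real.pi) Real.pi) (hz0 : z ≠ 0) :
    Complex.exp (Complex.I * z) ≠ 1 := by
  intro h
  have h1 := le_norm_one_sub_exp hz
  rw [h, sub_self, norm_zero] at h1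
  have : 0 < 2 / Real.pi * |z| := mul_pos (div_pos two_pos Real.pi_pos) (abs_pos.mpr hz0)
  linarith

/-- Since `g 0 > 0`, a point `z j` equal to `0` has the exponent `0`, hence the factor `1`
(`0 ^ 0 = 1` included). -/
theorem ne_zero_or_exponent_eq_zero {g h : ℝ → ℝ} {r : ℕ} {z a : Fin r → ℝ}
    (hg : ∀ x ∈ Icc (-Real.pi) Real.pi, g x = h x * ∏ j, |x - z j| ^ a j) (hg0 : 0 < g 0)
    (j : Fin r) : z j ≠ 0 ∨ a j = 0 := by
  by_contra! hj
  have h0 := hg 0 ⟨by linarith [Real.pi_pos], Real.pi_pos.le⟩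
  rw [Finset.prod_eq_zero (Finset.mem_univ j), mul_zero] at h0
  · exact hg0.ne' h0
  · rw [hj.1, sub_zero, abs_zero, Real.zero_rpow hj.2]

theorem ClassZL0Pos.continuousAt {g : ℝ → ℝ} (hg : ClassZL0Pos g) (hg0 : 0 < g 0) :
    ContinuousAt g 0 := by
  obtain ⟨h, r, z, a, hh, -, -, heq⟩ := hg
  have h1 : ContinuousAt (fun x => h x * ∏ j, |x - z j| ^ a j) 0 := by
    refine hh.continuousAt.mul (tendsto_finsetProd _ fun j _ => ?_)
    rcases ne_zero_or_exponent_eq_zero heq hg0 j with hj | hj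
    · refine ContinuousAt.rpow_const (f := fun x => |x - z j|) (by fun_prop) (Or.inl ?_)
      simpa using hj
    · simp only [hj, Real.rpow_zero]
      exact tendsto_const_nhds
  refine h1.congr ?_
  filter_upwards [Icc_mem_nhds (neg_lt_zero.mpr Real.pi_pos) Real.pi_pos] with x hx
  exact (heq x hx).symm

/-- The minorant is the product of the powers `|e^{ix} - e^{i z_j}|^{2k}` with `k = ⌈a_j⌉`,
each at most a constant times `|x - z_j|^{a_j}`. Exponents `a_j = 0` get `k = 0`, so that there is
no zero at `1`. -/
theorem ClassZL0Pos.exists_polynomial_mul_le {g : ℝ → ℝ} (hg : ClassZL0Pos g) (hg0 : 0 < g 0) :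
    ∃ (r : Polynomial ℂ) (κ : ℝ), 0 < κ ∧ r.eval 1 ≠ 0 ∧
      ∀ x ∈ Icc (-Real.pi) Real.pi, κ * ‖r.eval (Complex.exp (Complex.I * x))‖ ^ 2 ≤ g x := by
  obtain ⟨h, r, z, a, hh, hz, ha, heq⟩ := hg
  obtain ⟨c, hc0, hc⟩ := hh.lower_bound
  have hpi := Real.pi_pos
  have hM0 : 0 < ∏ j, (2 * Real.pi) ^ (2 * (⌈a j⌉₊ : ℝ) - a j) :=
    Finset.prod_pos fun j _ => by positivity
  refine ⟨∏ j, (Polynomial.X - Polynomial.C (Complex.exp (Complex.I * z j))) ^ ⌈a j⌉₊,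
    c / ∏ j, (2 * Real.pi) ^ (2 * (⌈a j⌉₊ : ℝ) - a j), by positivity, ?_, fun x hx => ?_⟩
  · rw [Polynomial.eval_prod]
    refine Finset.prod_ne_zero_iff.mpr fun j _ => ?_
    rcases ne_zero_or_exponent_eq_zero heq hg0 j with hj | hj
    · rw [Polynomial.eval_pow, Polynomial.eval_sub, Polynomial.eval_X, Polynomial.eval_C]
      exact pow_ne_zero _ (sub_ne_zero.mpr (exp_I_mul_ne_one (hz j) hj).symm)
    · simp [hj]
  · rw [heq x hx, div_mul_eq_mul_div, div_le_iff₀ hM0, mul_assoc, ← Finset.prod_mul_distrib]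
    have hprod : ‖(∏ j, (Polynomial.X - Polynomial.C (Complex.exp (Complex.I * z j))) ^
        ⌈a j⌉₊).eval (Complex.exp (Complex.I * x))‖ ^ 2 ≤
        ∏ j, |x - z j| ^ a j * (2 * Real.pi) ^ (2 * (⌈a j⌉₊ : ℝ) - a j) := by
      rw [Polynomial.eval_prod, norm_prod, ← Finset.prod_pow]
      refine Finset.prod_le_prod (fun j _ => by positivity) fun j _ => ?_
      have hceil := Nat.le_ceil (a j)
      have haj := ha j
      have hxz : |x - z j| ≤ 2 * Real.pi := by
        rw [abs_le]
        constructor <;> linarith [hx.1, hx.2, (hz j).1, (hz j).2]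
      simp only [Polynomial.eval_pow, Polynomial.eval_sub, Polynomial.eval_X, Polynomial.eval_C,
        norm_pow]
      calc _ ≤ (|x - z j| ^ ⌈a j⌉₊) ^ 2 := by
            gcongr
            exact norm_exp_sub_exp_le x (z j)
        _ = |x - z j| ^ (a j + (2 * (⌈a j⌉₊ : ℝ) - a j)) := by
            rw [← pow_mul, ← Real.rpow_natCast]
            congr 1
            push_cast
            ring
        _ = |x - z j| ^ a j * |x - z j| ^ (2 * (⌈a j⌉₊ : ℝ) - a j) :=
            Real.rpow_add_of_nonneg (abs_nonneg _) haj (by linarith)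
        _ ≤ _ := by
            gcongr
            linarith
    exact mul_le_mul (hc x hx) hprod (by positivity) (hc0.le.trans (hc x hx))

/-- If `|q|² ≤ g`, then `∫ |p|² f_α g` is at least the quadratic form of `f_α` at `p q`. -/
theorem minVar_le_specForm_of_sq_le {α : ℝ} (hα : -1 / 2 < α) {g : ℝ → ℝ}
    (hfg : IntervalIntegrable (fun x => fAlpha α x * g x) volume (-Real.pi) Real.pi)
    {q : Polynomial ℂ}
    (hq : ∀ x ∈ Icc (-Real.pi) Real.pi, ‖q.eval (Complex.exp (Complex.I * x))‖ ^ 2 ≤ g x)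
    {n : ℕ} {p : Polynomial ℂ} (hp : p.natDegree ≤ n) (hp1 : p.eval 1 = 1) :
    ‖q.eval 1‖ ^ 2 * minVar α (n + q.natDegree) ≤ specForm (fun x => fAlpha α x * g x) p := by
  have hdeg : (p * q).natDegree ≤ n + q.natDegree := Polynomial.natDegree_mul_le_of_le hp le_rfl
  have h := minVar_mul_le_specForm hα hdeg
  rw [Polynomial.eval_mul, hp1, one_mul] at h
  refine h.trans (intervalIntegral.integral_mono_on (by linarith [Real.pi_pos])
    (intervalIntegrable_specForm (intervalIntegrable_fAlpha hα) _)
    (intervalIntegrable_specForm hfg _) fun x hx => ?_)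
  have h1 := hq x hx
  have h2 := fAlpha_nonneg α x
  rw [Polynomial.eval_mul, norm_mul, mul_pow]
  calc _ = ‖p.eval (Complex.exp (Complex.I * x))‖ ^ 2 *
        (fAlpha α x * ‖q.eval (Complex.exp (Complex.I * x))‖ ^ 2) := by ring
    _ ≤ _ := mul_le_mul_of_nonneg_left (mul_le_mul_of_nonneg_left h1 h2) (by positivity)

theorem tendsto_rpow_mul_minVar_add {α : ℝ} (hα : -1 / 2 < α) (d : ℕ) :
    Tendsto (fun n : ℕ => (n : ℝ) ^ (2 * α + 1) * minVar α (n + d)) atTop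
      (𝓝 (Real.Gamma (2 * α + 1) / ProbabilityTheory.beta (α + 1) (α + 1))) := by
  have h1 := (tendsto_rpow_mul_minVar hα).comp (tendsto_add_atTop_nat d)
  have h2 : Tendsto (fun n : ℕ => ((n : ℝ) / (n + d)) ^ (2 * α + 1)) atTop (𝓝 1) := by
    have := (tendsto_natCast_div_add_atTop (𝕜 := ℝ) (d : ℝ)).rpow_const (p := 2 * α + 1)
      (Or.inl one_ne_zero)
    simpa using this
  have h3 := h2.mul h1
  rw [one_mul] at h3
  refine h3.congr' ?_
  filter_upwards [eventually_gt_atTop 0] with n hn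
  have hn' : (0 : ℝ) < n := by exact_mod_cast hn
  have hnd : (0 : ℝ) < n + d := by positivity
  simp only [Function.comp_apply]
  rw [Real.div_rpow hn'.le hnd.le, Nat.cast_add]
  have : ((n : ℝ) + d) ^ (2 * α + 1) ≠ 0 := by positivity
  field_simp

/-- Any sequence of variances between the minimal ones and those of `m̂_α` has the asymptotics of
the latter. -/
theorem tendsto_rpow_mul_of_le_specForm {α : ℝ} (hα : -1 / 2 < α) {g : ℝ → ℝ}
    (hg : ClassZL0Pos g) (hg0 : 0 < g 0)
    (hfg : IntervalIntegrable (fun x => fAlpha α x * g x) volume (-Real.pi) Real.pi)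
    {p : ℕ → Polynomial ℂ} (hp : ∀ n, (p n).natDegree ≤ n) (hp1 : ∀ n, (p n).eval 1 = 1)
    (hle : ∀ n, specForm (fun x => fAlpha α x * g x) (p n) ≤
      specForm (fun x => fAlpha α x * g x) (alphaPoly α n)) :
    Tendsto (fun n : ℕ => (n : ℝ) ^ (2 * α + 1) * specForm (fun x => fAlpha α x * g x) (p n))
      atTop (𝓝 (g 0 * (Real.Gamma (2 * α + 1) / ProbabilityTheory.beta (α + 1) (α + 1)))) := by
  set L := Real.Gamma (2 * α + 1) / ProbabilityTheory.beta (α + 1) (α + 1) with hL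
  have hL0 : 0 < L := div_pos (Real.Gamma_pos_of_pos (by linarith)) (beta_add_one_pos hα)
  have hcont := hg.continuousAt hg0
  have hup := tendsto_rpow_mul_specForm_alphaPoly hα hcont hfg
  rw [← hL] at hup
  refine tendsto_order.mpr ⟨fun y hy => ?_, fun y hy => ?_⟩
  · -- a level `t < g 0` of the minorant with `y < t * L`
    obtain ⟨t, ht1, ht2⟩ : ∃ t, max 0 (y / L) < t ∧ t < g 0 :=
      exists_between (max_lt hg0 (by rwa [div_lt_iff₀ hL0]))
    have ht0 : 0 < t := (le_max_left _ _).trans_lt ht1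
    have hyt : y < t * L := by
      rw [← div_lt_iff₀ hL0]
      exact (le_max_right _ _).trans_lt ht1
    obtain ⟨r, κ, hκ, hr1, hr⟩ := hg.exists_polynomial_mul_le hg0
    obtain ⟨q, hq1, hq⟩ := exists_polynomial_sq_le_of_le hκ hr1 hr hcont ht0 ht2
    have hlow := (tendsto_rpow_mul_minVar_add hα q.natDegree).const_mul t
    filter_upwards [hlow.eventually_const_lt hyt] with n hn
    refine hn.trans_le ?_
    have h := minVar_le_specForm_of_sq_le hα hfg hq (hp n) (hp1 n)
    rw [hq1] at h
    calc _ = (n : ℝ) ^ (2 * α + 1) * (t * minVar α (n + q.natDegree)) := by ring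
      _ ≤ _ := by gcongr
  · filter_upwards [hup.eventually_lt_const hy] with n hn
    refine lt_of_le_of_lt ?_ hn
    have := hle n
    gcongr

/-! ### The spectral representation of the variance -/

section RCLikeMap

variable {𝕜 : Type*} [RCLike 𝕜]

/-- `RCLike.map 𝕜 ℂ` is only declared as a real linear map; it is multiplicative, because either
`I = 0` and `𝕜` is a copy of `ℝ`, or `𝕜` is a copy of `ℂ`. -/
theorem rclike_map_mul (z w : 𝕜) :
    RCLike.map 𝕜 ℂ (z * w) = RCLike.map 𝕜 ℂ z * RCLike.map 𝕜 ℂ w := by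
  apply Complex.ext <;> simp [RCLike.mul_re, RCLike.mul_im]

theorem rclike_map_conj (z : 𝕜) : RCLike.map 𝕜 ℂ (conj z) = conj (RCLike.map 𝕜 ℂ z) := by
  apply Complex.ext <;> simp

theorem rclike_map_norm (z : 𝕜) : ‖RCLike.map 𝕜 ℂ z‖ = ‖z‖ := by
  rw [← sq_eq_sq₀ (norm_nonneg _) (norm_nonneg _), ← Complex.normSq_eq_norm_sq,
    ← RCLike.normSq_eq_def', Complex.normSq_apply, RCLike.normSq_apply]
  simp

theorem rclike_map_ofReal (x : ℝ) : RCLike.map 𝕜 ℂ (x : 𝕜) = (x : ℂ) := by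
  apply Complex.ext <;> simp

theorem rclike_map_injective : Function.Injective (RCLike.map 𝕜 ℂ) := by
  rw [injective_iff_map_eq_zero]
  intro z hz
  rw [← norm_eq_zero, ← rclike_map_norm, hz, norm_zero]

end RCLikeMap

variable {𝕜 Ω : Type*} [RCLike 𝕜] [MeasurableSpace Ω] {P : Measure Ω} {Y : ℤ → Ω → 𝕜} {f : ℝ → ℝ}

/-- The polynomial `∑ c_k z^k` of a vector of weights, with complex coefficients. -/
noncomputable def weightPoly {n : ℕ} (c : Fin (n + 1) → 𝕜) : Polynomial ℂ :=
  ∑ k : Fin (n + 1), Polynomial.C (RCLike.map 𝕜 ℂ (c k)) * Polynomial.X ^ (k : ℕ)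

theorem eval_weightPoly {n : ℕ} (c : Fin (n + 1) → 𝕜) (z : ℂ) :
    (weightPoly c).eval z = ∑ k : Fin (n + 1), RCLike.map 𝕜 ℂ (c k) * z ^ (k : ℕ) := by
  simp [weightPoly, Polynomial.eval_finsetSum]

theorem eval_one_weightPoly {n : ℕ} {c : Fin (n + 1) → 𝕜} (hc : ∑ k, c k = 1) :
    (weightPoly c).eval 1 = 1 := by
  rw [eval_weightPoly]
  simp only [one_pow, mul_one]
  rw [← map_sum, hc]
  simp

theorem natDegree_weightPoly_le {n : ℕ} (c : Fin (n + 1) → 𝕜) : (weightPoly c).natDegree ≤ n :=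
  Polynomial.natDegree_sum_le_of_forall_le _ _ fun k _ =>
    (Polynomial.natDegree_C_mul_X_pow_le _ _).trans (Nat.lt_succ_iff.mp k.2)

theorem coeff_weightPoly {n : ℕ} (c : Fin (n + 1) → 𝕜) (k : Fin (n + 1)) :
    (weightPoly c).coeff k = RCLike.map 𝕜 ℂ (c k) := by
  rw [weightPoly, Polynomial.finsetSum_coeff, Finset.sum_eq_single k]
  · rw [Polynomial.coeff_C_mul_X_pow, if_pos rfl]
  · intro j _ hj
    rw [Polynomial.coeff_C_mul_X_pow, if_neg]
    exact fun h => hj (Fin.ext h.symm)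
  · simp

theorem weightPoly_alphaWeights (α : ℝ) (n : ℕ) :
    weightPoly (alphaWeights 𝕜 α n) = alphaPoly α n := by
  rw [weightPoly, alphaPoly, ← Fin.sum_univ_eq_sum_range
    (fun k => Polynomial.C (alphaCoef α n k : ℂ) * Polynomial.X ^ k)]
  refine Finset.sum_congr rfl fun k _ => ?_
  rw [alphaWeights, rclike_map_ofReal]
  rfl

theorem HasSpectralDensity.intervalIntegrable (hY : HasSpectralDensity P Y f) :
    IntervalIntegrable f volume (-Real.pi) Real.pi := by
  rw [intervalIntegrable_iff_integrableOn_Icc_of_le (by linarith [Real.pi_pos])]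
  exact hY.density_integrable

theorem HasSpectralDensity.memLp_linearEstimator (hY : HasSpectralDensity P Y f) {n : ℕ}
    (c : Fin (n + 1) → 𝕜) : MemLp (linearEstimator Y c) 2 P :=
  memLp_finsetSum _ fun k _ => (hY.memLp k).const_mul (c k)

theorem HasSpectralDensity.integrable_mul_conj (hY : HasSpectralDensity P Y f) (s t : ℤ) :
    Integrable (fun ω => Y s ω * conj (Y t ω)) P :=
  (hY.memLp s).integrable_mul (hY.memLp t).star

/-- The isometry between the span of `Y(0), …, Y(n)` in `L²(P)` and the polynomials of degree at
most `n` in `L²(f)`. -/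
theorem HasSpectralDensity.integral_norm_sq (hY : HasSpectralDensity P Y f) {n : ℕ}
    (c : Fin (n + 1) → 𝕜) :
    ∫ ω, ‖linearEstimator Y c ω‖ ^ 2 ∂P = specForm f (weightPoly c) := by
  have hf := hY.intervalIntegrable
  have hcov : ∀ j k : Fin (n + 1), ∫ ω, RCLike.map 𝕜 ℂ (Y (j : ℕ) ω * conj (Y (k : ℕ) ω)) ∂P =
      ∫ x in (-Real.pi)..Real.pi,
        Complex.exp (Complex.I * (((j : ℕ) - (k : ℕ) : ℤ) : ℂ) * x) * (f x : ℂ) := by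
    intro j k
    have h := hY.covariance (k : ℕ) ((j : ℕ) - (k : ℕ))
    rw [add_sub_cancel] at h
    rw [← h]
    exact (RCLike.map 𝕜 ℂ).integral_comp_comm (hY.integrable_mul_conj _ _)
  have hint : ∀ j k : Fin (n + 1),
      Integrable (fun ω => RCLike.map 𝕜 ℂ (Y (j : ℕ) ω * conj (Y (k : ℕ) ω))) P :=
    fun j k => (RCLike.map 𝕜 ℂ).integrable_comp (hY.integrable_mul_conj _ _)
  have hintf : ∀ j k : Fin (n + 1), IntervalIntegrable (fun x : ℝ =>
      RCLike.map 𝕜 ℂ (c j) * conj (RCLike.map 𝕜 ℂ (c k)) *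
        (Complex.exp (Complex.I * (((j : ℕ) - (k : ℕ) : ℤ) : ℂ) * x) * (f x : ℂ))) volume
      (-Real.pi) Real.pi :=
    fun j k => (intervalIntegrable_exp_mul_ofReal hf _).const_mul _
  have hl : ∀ ω, ((‖linearEstimator Y c ω‖ ^ 2 : ℝ) : ℂ) = ∑ j : Fin (n + 1),
      ∑ k : Fin (n + 1), RCLike.map 𝕜 ℂ (c j) * conj (RCLike.map 𝕜 ℂ (c k)) *
        RCLike.map 𝕜 ℂ (Y (j : ℕ) ω * conj (Y (k : ℕ) ω)) := by
    intro ω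
    rw [← rclike_map_norm, ← Complex.normSq_eq_norm_sq, ← Complex.mul_conj, linearEstimator,
      map_sum, map_sum, Finset.sum_mul_sum]
    refine Finset.sum_congr rfl fun j _ => Finset.sum_congr rfl fun k _ => ?_
    simp only [rclike_map_mul, rclike_map_conj, map_mul]
    ring
  have hr : ∀ x : ℝ, ((‖(weightPoly c).eval (Complex.exp (Complex.I * x))‖ ^ 2 * f x : ℝ) : ℂ) =
      ∑ j : Fin (n + 1), ∑ k : Fin (n + 1),
        RCLike.map 𝕜 ℂ (c j) * conj (RCLike.map 𝕜 ℂ (c k)) *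
        (Complex.exp (Complex.I * (((j : ℕ) - (k : ℕ) : ℤ) : ℂ) * x) * (f x : ℂ)) := by
    intro x
    rw [Complex.ofReal_mul, ← Complex.normSq_eq_norm_sq, ← Complex.mul_conj, eval_weightPoly,
      map_sum, Finset.sum_mul_sum, Finset.sum_mul]
    refine Finset.sum_congr rfl fun j _ => ?_
    rw [Finset.sum_mul]
    refine Finset.sum_congr rfl fun k _ => ?_
    rw [← exp_I_mul_pow_mul_conj_pow, map_mul]
    ring
  rw [← Complex.ofReal_inj, specForm, ← integral_complex_ofReal,
    ← intervalIntegral.integral_ofReal]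
  simp only [hl, hr]
  rw [integral_finsetSum _ fun j _ => integrable_finsetSum _ fun k _ => (hint j k).const_mul _,
    intervalIntegral.integral_finsetSum]
  · refine Finset.sum_congr rfl fun j _ => ?_
    rw [integral_finsetSum _ fun k _ => (hint j k).const_mul _,
      intervalIntegral.integral_finsetSum fun k _ => hintf j k]
    refine Finset.sum_congr rfl fun k _ => ?_
    rw [integral_const_mul, intervalIntegral.integral_const_mul, hcov]
  · intro j _
    have := IntervalIntegrable.sum Finset.univ fun k _ => hintf j k
    simpa only [Finset.sum_fn] using this

theorem HasSpectralDensity.estimatorVar_eq (hY : HasSpectralDensity P Y f) {m : 𝕜}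
    {X : ℤ → Ω → 𝕜} (hX : ∀ t ω, X t ω = m + Y t ω) {n : ℕ} {c : Fin (n + 1) → 𝕜}
    (hc : ∑ k, c k = 1) : estimatorVar P X m c = specForm f (weightPoly c) := by
  rw [← hY.integral_norm_sq, estimatorVar]
  congr 1
  funext ω
  have : linearEstimator X c ω - m = linearEstimator Y c ω := by
    simp only [linearEstimator, hX, mul_add, Finset.sum_add_distrib]
    rw [← Finset.sum_mul, hc, one_mul, add_sub_cancel_left]
  rw [this]

/-! ### Existence and uniqueness of the BLUE -/

/-- A polynomial vanishing almost everywhere on the unit circle is zero, so the quadratic form of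
an almost everywhere positive density is definite. -/
theorem eq_zero_of_specForm_eq_zero (hf : IntervalIntegrable f volume (-Real.pi) Real.pi)
    (hf0 : ∀ x ∈ Icc (-Real.pi) Real.pi, 0 ≤ f x)
    (hpos : ∀ᵐ x ∂volume.restrict (Ioc (-Real.pi) Real.pi), 0 < f x) {Q : Polynomial ℂ}
    (hQ : specForm f Q = 0) : Q = 0 := by
  have hpi : -Real.pi ≤ Real.pi := by linarith [Real.pi_pos]
  have hnn : 0 ≤ᵐ[volume.restrict (Ioc (-Real.pi) Real.pi)]
      fun x : ℝ => ‖Q.eval (Complex.exp (Complex.I * x))‖ ^ 2 * f x := by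
    filter_upwards [ae_restrict_mem measurableSet_Ioc] with x hx
    exact mul_nonneg (by positivity) (hf0 x (Ioc_subset_Icc_self hx))
  have h0 := (intervalIntegral.integral_eq_zero_iff_of_le_of_nonneg_ae hpi hnn
    (intervalIntegrable_specForm hf Q)).mp hQ
  have hae : ∀ᵐ x ∂volume.restrict (Ioc (-Real.pi) Real.pi),
      Q.eval (Complex.exp (Complex.I * (x : ℝ))) = 0 := by
    filter_upwards [h0, hpos] with x hx hfx
    simpa [hfx.ne'] using hx
  by_contra hne
  have hfin : {x : ℝ | x ∈ Ioc (-Real.pi) Real.pi ∧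
      Q.eval (Complex.exp (Complex.I * x)) = 0}.Finite := by
    refine Set.Finite.of_finite_image (f := fun x : ℝ => Complex.exp (Complex.I * x))
      ((Polynomial.finite_setOfPred_isRoot hne).subset ?_) ?_
    · rintro _ ⟨x, hx, rfl⟩
      exact hx.2
    · intro x hx y hy hxy
      simp only at hxy
      have hx' : Complex.arg (Complex.exp (Complex.I * x)) = x := by
        rw [mul_comm, Complex.arg_exp_mul_I, toIocMod_eq_self]
        simpa [two_mul] using hx.1
      have hy' : Complex.arg (Complex.exp (Complex.I * y)) = y := by
        rw [mul_comm, Complex.arg_exp_mul_I, toIocMod_eq_self]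
        simpa [two_mul] using hy.1
      rw [← hx', ← hy', hxy]
  rw [ae_restrict_iff' measurableSet_Ioc, ae_iff] at hae
  have hsub : Ioc (-Real.pi) Real.pi ⊆
      {x : ℝ | ¬(x ∈ Ioc (-Real.pi) Real.pi → Q.eval (Complex.exp (Complex.I * x)) = 0)} ∪
      {x : ℝ | x ∈ Ioc (-Real.pi) Real.pi ∧ Q.eval (Complex.exp (Complex.I * x)) = 0} := by
    intro x hx
    by_cases h : Q.eval (Complex.exp (Complex.I * x)) = 0
    · exact Or.inr ⟨hx, h⟩
    · exact Or.inl fun h' => h (h' hx)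
  have hzero := measure_mono_null hsub (measure_union_null hae (hfin.measure_zero volume))
  rw [Real.volume_Ioc, ENNReal.ofReal_eq_zero] at hzero
  linarith [Real.pi_pos]

/-- An injective linear image of the hyperplane `ℓ = 1` of a finite-dimensional space has exactly
one point nearest to the origin. -/
theorem exists_forall_isMinOn_norm_iff {V H : Type*} [AddCommGroup V] [Module 𝕜 V]
    [FiniteDimensional 𝕜 V] [NormedAddCommGroup H] [InnerProductSpace 𝕜 H] (Φ : V →ₗ[𝕜] H)
    (hΦ : Function.Injective Φ) (l : V →ₗ[𝕜] 𝕜) {v : V} (hv : l v = 1) :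
    ∃ b : V, l b = 1 ∧ ∀ c, (l c = 1 ∧ ∀ d, l d = 1 → ‖Φ c‖ ≤ ‖Φ d‖) ↔ c = b := by
  set K : Submodule 𝕜 H := (LinearMap.ker l).map Φ with hK
  obtain ⟨u, hu, huv⟩ := Submodule.mem_map.mp (K.starProjection_apply_mem (Φ v))
  have hlb : l (v - u) = 1 := by
    rw [map_sub, hv, LinearMap.mem_ker.mp hu, sub_zero]
  have hpyth : ∀ c, l c = 1 → ‖Φ c‖ * ‖Φ c‖ =
      ‖Φ (v - u)‖ * ‖Φ (v - u)‖ + ‖Φ (c - (v - u))‖ * ‖Φ (c - (v - u))‖ := by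
    intro c hc
    rw [← norm_add_sq_eq_norm_sq_add_norm_sq_of_inner_eq_zero (𝕜 := 𝕜), ← map_add,
      add_sub_cancel]
    have hmem : Φ (c - (v - u)) ∈ K := Submodule.mem_map_of_mem (by
      rw [LinearMap.mem_ker, map_sub, hc, hlb, sub_self])
    rw [map_sub Φ v u, huv]
    exact K.starProjection_inner_eq_zero _ _ hmem
  refine ⟨v - u, hlb, fun c => ⟨fun ⟨hc, hmin⟩ => ?_, ?_⟩⟩
  · have h1 := hpyth c hc
    have h2 := hmin (v - u) hlb
    have h3 : ‖Φ (c - (v - u))‖ = 0 := by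
      have : ‖Φ c‖ * ‖Φ c‖ ≤ ‖Φ (v - u)‖ * ‖Φ (v - u)‖ := by gcongr
      nlinarith [norm_nonneg (Φ (c - (v - u)))]
    rw [norm_eq_zero, map_eq_zero_iff Φ hΦ] at h3
    exact sub_eq_zero.mp h3
  · rintro rfl
    refine ⟨hlb, fun d hd => ?_⟩
    have h1 := hpyth d hd
    rw [mul_self_le_mul_self_iff (norm_nonneg _) (norm_nonneg _), h1]
    exact le_add_of_nonneg_right (by positivity)

/-- The linear map sending weights to the corresponding linear combination in `L²(P)`. -/
noncomputable def HasSpectralDensity.estimatorLp (hY : HasSpectralDensity P Y f) (n : ℕ) :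
    (Fin (n + 1) → 𝕜) →ₗ[𝕜] Lp 𝕜 2 P where
  toFun c := (hY.memLp_linearEstimator c).toLp _
  map_add' c d := by
    rw [← MemLp.toLp_add]
    congr 1
    funext ω
    simp [linearEstimator, add_mul, Finset.sum_add_distrib]
  map_smul' a c := by
    rw [RingHom.id_apply, ← MemLp.toLp_const_smul]
    congr 1
    funext ω
    simp [linearEstimator, Finset.mul_sum, mul_assoc]

theorem HasSpectralDensity.norm_estimatorLp_sq (hY : HasSpectralDensity P Y f) {n : ℕ}
    (c : Fin (n + 1) → 𝕜) : ‖hY.estimatorLp n c‖ ^ 2 = specForm f (weightPoly c) := by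
  have h0 : 0 ≤ ∫ ω, ‖linearEstimator Y c ω‖ ^ 2 ∂P :=
    integral_nonneg fun ω => by positivity
  have h1 : ‖hY.estimatorLp n c‖ = (eLpNorm (linearEstimator Y c) 2 P).toReal :=
    Lp.norm_toLp _ (hY.memLp_linearEstimator c)
  rw [h1, (hY.memLp_linearEstimator c).eLpNorm_eq_integral_rpow_norm two_ne_zero
    ENNReal.ofNat_ne_top, ← hY.integral_norm_sq]
  simp only [ENNReal.toReal_ofNat, Real.rpow_ofNat]
  rw [ENNReal.toReal_ofReal (by positivity), ← Real.rpow_natCast, ← Real.rpow_mul h0]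
  norm_num

theorem HasSpectralDensity.exists_isBLUE_iff (hY : HasSpectralDensity P Y f)
    (hpos : ∀ᵐ x ∂volume.restrict (Ioc (-Real.pi) Real.pi), 0 < f x) {m : 𝕜}
    {X : ℤ → Ω → 𝕜} (hX : ∀ t ω, X t ω = m + Y t ω) (n : ℕ) :
    ∃ b : Fin (n + 1) → 𝕜, ∑ k, b k = 1 ∧ ∀ c : Fin (n + 1) → 𝕜, IsBLUE P X m c ↔ c = b := by
  have hinj : Function.Injective (hY.estimatorLp n) := by
    rw [injective_iff_map_eq_zero]
    intro c hc
    have h1 := hY.norm_estimatorLp_sq c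
    rw [hc, norm_zero, zero_pow two_ne_zero] at h1
    have h2 := eq_zero_of_specForm_eq_zero hY.intervalIntegrable hY.density_nonneg hpos h1.symm
    funext k
    have h3 := coeff_weightPoly c k
    rw [h2, Polynomial.coeff_zero] at h3
    exact rclike_map_injective (by rw [← h3, Pi.zero_apply, map_zero])
  set l : (Fin (n + 1) → 𝕜) →ₗ[𝕜] 𝕜 := ∑ k, LinearMap.proj k with hl
  have hlc : ∀ c, l c = ∑ k, c k := fun c => by simp [hl]
  obtain ⟨b, hb1, hb⟩ := exists_forall_isMinOn_norm_iff (hY.estimatorLp n) hinj l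
    (v := Pi.single 0 1) (by simp [hlc])
  refine ⟨b, by rw [← hlc, hb1], fun c => ?_⟩
  rw [← hb c, IsBLUE, hlc]
  refine and_congr_right fun hc => forall_congr' fun d => ?_
  rw [hlc]
  refine imp_congr_right fun hd => ?_
  rw [hY.estimatorVar_eq hX hc, hY.estimatorVar_eq hX hd, ← hY.norm_estimatorLp_sq,
    ← hY.norm_estimatorLp_sq, sq_le_sq₀ (norm_nonneg _) (norm_nonneg _)]

theorem ClassZL0Pos.ae_pos {g : ℝ → ℝ} (hg : ClassZL0Pos g) (α : ℝ) :
    ∀ᵐ x ∂volume.restrict (Ioc (-Real.pi) Real.pi), 0 < fAlpha α x * g x := by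
  obtain ⟨h, r, z, a, hh, -, -, heq⟩ := hg
  obtain ⟨c, hc0, hc⟩ := hh.lower_bound
  have hfin : ({0} ∪ range z : Set ℝ).Finite := (finite_singleton 0).union (finite_range z)
  filter_upwards [ae_restrict_mem measurableSet_Ioc,
    ae_restrict_of_ae (compl_mem_ae_iff.mpr (hfin.measure_zero volume))] with x hx hxz
  have hx' := Ioc_subset_Icc_self hx
  simp only [mem_union, mem_singleton_iff, mem_range, not_or, not_exists] at hxz
  rw [heq x hx']
  refine mul_pos (fAlpha_pos hx' hxz.1) (mul_pos (hc0.trans_le (hc x hx')) ?_)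
  refine Finset.prod_pos fun j _ => Real.rpow_pos_of_pos (abs_pos.mpr (sub_ne_zero.mpr ?_)) _
  exact fun h => hxz.2 j h.symm

theorem sum_alphaWeights {α : ℝ} (hα : -1 / 2 < α) (n : ℕ) :
    ∑ k, alphaWeights 𝕜 α n k = 1 := by
  have h := sum_alphaCoef hα n
  rw [← Fin.sum_univ_eq_sum_range] at h
  have h2 : ∑ k, alphaWeights 𝕜 α n k = ((∑ k : Fin (n + 1), alphaCoef α n k : ℝ) : 𝕜) := by
    rw [RCLike.ofReal_sum]
    rfl
  rw [h2, h, RCLike.ofReal_one]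

end MeanBLUE

theorem theorem5p8 {𝕜 Ω : Type*} [RCLike 𝕜] [MeasurableSpace Ω]
    (P : Measure Ω) [IsProbabilityMeasure P]
    (α : ℝ) (hα : -1 / 2 < α)
    (g : ℝ → ℝ) (hg : MeanBLUE.ClassZL0Pos g) (hg0 : 0 < g 0)
    (m : 𝕜) (X Y : ℤ → Ω → 𝕜) (hX : ∀ t ω, X t ω = m + Y t ω)
    (hY : MeanBLUE.HasSpectralDensity P Y (fun x => MeanBLUE.fAlpha α x * g x)) :
    ∃ b : (n : ℕ) → Fin (n + 1) → 𝕜,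
      -- `b n` is the unique vector of weights of the BLUE based on `X(0), …, X(n)`
      (∀ (n : ℕ) (c : Fin (n + 1) → 𝕜), MeanBLUE.IsBLUE P X m c ↔ c = b n) ∧
      (fun n : ℕ => MeanBLUE.estimatorVar P X m (b n)) ~[atTop]
        (fun n : ℕ => (n : ℝ) ^ (-2 * α - 1) * Real.Gamma (2 * α + 1) * g 0 /
          ProbabilityTheory.beta (α + 1) (α + 1)) ∧
      (∀ n : ℕ, ∑ k, MeanBLUE.alphaWeights 𝕜 α n k = 1) ∧
      Tendsto
        (fun n : ℕ => MeanBLUE.estimatorVar P X m (b n) /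
          MeanBLUE.estimatorVar P X m (MeanBLUE.alphaWeights 𝕜 α n))
        atTop (𝓝 1) := by
  have hfg := hY.intervalIntegrable
  choose b hb1 hb using fun n => hY.exists_isBLUE_iff (hg.ae_pos α) hX n
  have hA := MeanBLUE.sum_alphaWeights (𝕜 := 𝕜) hα
  have hle : ∀ n, MeanBLUE.specForm (fun x => MeanBLUE.fAlpha α x * g x)
      (MeanBLUE.weightPoly (b n)) ≤
      MeanBLUE.specForm (fun x => MeanBLUE.fAlpha α x * g x) (MeanBLUE.alphaPoly α n) := by
    intro n
    have h := ((hb n (b n)).mpr rfl).2 _ (hA n)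
    rwa [hY.estimatorVar_eq hX (hb1 n), hY.estimatorVar_eq hX (hA n),
      MeanBLUE.weightPoly_alphaWeights] at h
  have hlimA := MeanBLUE.tendsto_rpow_mul_specForm_alphaPoly hα (hg.continuousAt hg0) hfg
  have hlimB := MeanBLUE.tendsto_rpow_mul_of_le_specForm hα hg hg0 hfg
    (fun n => MeanBLUE.natDegree_weightPoly_le (b n))
    (fun n => MeanBLUE.eval_one_weightPoly (hb1 n)) hle
  have hGamma : 0 < Real.Gamma (2 * α + 1) := Real.Gamma_pos_of_pos (by linarith)
  have hBeta := MeanBLUE.beta_add_one_pos hα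
  have hlim0 : g 0 * (Real.Gamma (2 * α + 1) / ProbabilityTheory.beta (α + 1) (α + 1)) ≠ 0 := by
    positivity
  refine ⟨b, hb, ?_, hA, ?_⟩
  · refine (isEquivalent_iff_tendsto_one ?_).mpr ?_
    · filter_upwards [eventually_gt_atTop 0] with n hn
      have hn' : (0 : ℝ) < n := by exact_mod_cast hn
      positivity
    · have h := hlimB.div_const
        (g 0 * (Real.Gamma (2 * α + 1) / ProbabilityTheory.beta (α + 1) (α + 1)))
      rw [div_self hlim0] at h
      refine h.congr' ?_
      filter_upwards [eventually_gt_atTop 0] with n hn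
      have hn' : (0 : ℝ) < n := by exact_mod_cast hn
      have hpow : (n : ℝ) ^ (-2 * α - 1) = ((n : ℝ) ^ (2 * α + 1))⁻¹ := by
        rw [← Real.rpow_neg hn'.le]
        congr 1
        ring
      have hpow0 : (0 : ℝ) < (n : ℝ) ^ (2 * α + 1) := by positivity
      rw [Pi.div_apply, hY.estimatorVar_eq hX (hb1 n), hpow]
      field_simp
  · have h := hlimB.div hlimA hlim0
    rw [div_self hlim0] at h
    refine h.congr' ?_
    filter_upwards [eventually_gt_atTop 0] with n hn
    have hn' : (0 : ℝ) < n := by exact_mod_cast hn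
    have hpow0 : (0 : ℝ) < (n : ℝ) ^ (2 * α + 1) := by positivity
    rw [Pi.div_apply, hY.estimatorVar_eq hX (hb1 n), hY.estimatorVar_eq hX (hA n),
      MeanBLUE.weightPoly_alphaWeights, mul_div_mul_left _ _ hpow0.ne']
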